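/- Let $F$ be a nonarchimedean local field with ring of integers $\mathfrak{o}_F$ and residue field $\mathbb{F}_q$ of order $q$. Let $G=GL(2,F)$, let $Z$ be its center, and let $K=GL(2,\mathfrak{o}_F)$. Let $\Lambda_0$ be a cuspidal representation of $GL(2,\mathbb{F}_q)$, that is, an irreducible representation on a finite-dimensional complex vector space $V$ that is not equivalent to a subrepresentation of any representation induced from a character of the upper-triangular subgroup inflated from a character of the diagonal subgroup. Let $\Lambda$ be a representation of $ZK$ on $V$ whose restriction to $K$ is the inflation of $\Lambda_0$ along $K\to GL(2,\mathbb{F}_q)$, and on which $Z$ acts by a unitary character. Let $\pi=\text{c-Ind}_{ZK}^{G}\Lambda$ be the compactly induced representation of $G$ (a depth-zero supercuspidal representation): $G$ acts by right translation on the space of functions $f:G\to V$ such that $f(jg)=\Lambda(j)f(g)$ for $j\in ZK$, $f$ is right-invariant under some open subgroup of $G$, and $f$ is compactly supported modulo $ZK$. Normalize Haar measure on $G/Z$ so that $$\operatorname{vol}(ZK/Z)=\tfrac{1}{2}(q-1).$$ Then $\pi$ has a unitary completion: it embeds $G$-equivariantly as a dense subspace of a Hilbert space carrying a (strongly continuous)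 unitary representation of $G$. Every such completion $(\pi,\mathcal{H})$ is a discrete series representation, i.e. it is an irreducible unitary representation whose matrix coefficients are square-integrable modulo $Z$, and its formal dimension is $$d_\pi=2,$$ i.e. for all $u,v,u',v'\in\mathcal{H}$ $$\int_{G/Z}(\pi(g)u,v)\,\overline{(\pi(g)u',v')}\,d\dot g=\frac{1}{2}\,(u,u')\,\overline{(v,v')}.$$ -/

import Mathlib

open MeasureTheory ValuativeRel Matrix
open scoped Pointwise MatrixGroups ComplexConjugate

universe u v w

noncomputable section

/-! ### Cuspidal representations of `GL(2)` over a field -/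

/-- The subgroup of upper-triangular matrices of `GL(2, k)`. -/
def upperTriangularGL2 (k : Type*) [Field k] : Subgroup (GL (Fin 2) k) where
  carrier := {g | g 1 0 = 0}
  mul_mem' {a b} ha hb := by
    simp only [Set.mem_ofPred_eq] at *
    simp [Matrix.mul_apply, Fin.sum_univ_two, ha, hb]
  one_mem' := by simp
  inv_mem' {a} ha := by
    simp only [Set.mem_ofPred_eq] at *
    simp [Matrix.inv_def, Matrix.adjugate_fin_two, ha]

theorem upperTriangularGL2_diag_ne_zero {k : Type*} [Field k] (b : upperTriangularGL2 k) :
    (b : GL (Fin 2) k) 0 0 ≠ 0 ∧ (b : GL (Fin 2) k) 1 1 ≠ 0 := by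
  have h : (b : GL (Fin 2) k) 1 0 = 0 := b.2
  have hd : ((b : GL (Fin 2) k) : Matrix (Fin 2) (Fin 2) k).det ≠ 0 :=
    ((Matrix.isUnit_iff_isUnit_det _).1 (b : GL (Fin 2) k).isUnit).ne_zero
  rw [Matrix.det_fin_two, h, mul_zero, sub_zero] at hd
  exact mul_ne_zero_iff.1 hd

/-- The projection of an upper-triangular matrix to its diagonal entries. -/
def diagonalPart (k : Type*) [Field k] : upperTriangularGL2 k →* kˣ × kˣ where
  toFun b := (Units.mk0 _ (upperTriangularGL2_diag_ne_zero b).1,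
    Units.mk0 _ (upperTriangularGL2_diag_ne_zero b).2)
  map_one' := by
    ext <;> simp
  map_mul' a b := by
    have ha : (a : GL (Fin 2) k) 1 0 = 0 := a.2
    have hb : (b : GL (Fin 2) k) 1 0 = 0 := b.2
    ext <;> simp [Matrix.mul_apply, Fin.sum_univ_two, ha, hb]

/-- The character of the upper-triangular group inflated from a character `χ` of the diagonal
group, as a one-dimensional representation. -/
def inflatedCharacter {k : Type*} [Field k] (χ : kˣ × kˣ →* ℂˣ) :
    Representation ℂ (upperTriangularGL2 k) ℂ :=
  (algebraMap ℂ (Module.End ℂ ℂ)).toMonoidHom.comp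
    ((Units.coeHom ℂ).comp (χ.comp (diagonalPart k)))

/-- The representation of `GL(2, k)` induced from a character `χ` of the diagonal group, inflated
to the upper-triangular group (functions on `GL(2, k)`, with right translation). -/
def principalSeries {k : Type*} [Field k] (χ : kˣ × kˣ →* ℂˣ) :=
  Representation.coind (upperTriangularGL2 k).subtype (inflatedCharacter χ)

/-- An irreducible representation of `GL(2, k)` (for `k` a finite field) is cuspidal if it is not
equivalent to a subrepresentation of any representation induced from an inflated character. -/
def IsCuspidal {k : Type*} [Field k] {V : Type*} [AddCommGroup V] [Module ℂ V]
    (ρ : Representation ℂ (GL (Fin 2) k) V) : Prop :=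
  ρ.IsIrreducible ∧ ∀ χ : kˣ × kˣ →* ℂˣ,
    ¬ ∃ f : ρ.IntertwiningMap (principalSeries χ), Function.Injective f

/-! ### Compact induction -/

section CompactInduction

variable {G : Type*} [Group G] [TopologicalSpace G] [IsTopologicalGroup G]
  {V : Type*} [AddCommGroup V] [Module ℂ V]

/-- The space of `c-Ind_J^G Λ`: the functions `f : G → V` with `f (j g) = Λ(j) f(g)` that are
invariant under right translation by an open subgroup and compactly supported modulo `J`. -/
def compactInductionSpace (J : Subgroup G) (Λ : Representation ℂ J V) : Submodule ℂ (G → V) where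
  carrier := {f | (∀ (j : J) (g : G), f (j * g) = Λ j (f g)) ∧
    (∃ U : OpenSubgroup G, ∀ u ∈ U, ∀ g, f (g * u) = f g) ∧
    ∃ C : Set G, IsCompact C ∧ Function.support f ⊆ (J : Set G) * C}
  zero_mem' := ⟨by simp, ⟨⊤, by simp⟩, ∅, isCompact_empty, by simp⟩
  add_mem' := by
    rintro f f' ⟨h1, ⟨U, hU⟩, C, hC, hfC⟩ ⟨h1', ⟨U', hU'⟩, C', hC', hfC'⟩
    refine ⟨fun j g => by simp [h1, h1'], ⟨U ⊓ U', fun u hu g => ?_⟩, C ∪ C', hC.union hC', ?_⟩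
    · simp [hU u hu.1, hU' u hu.2]
    · rw [Set.mul_union]
      exact (Function.support_add f f').trans (Set.union_subset_union hfC hfC')
  smul_mem' := by
    rintro c f ⟨h1, ⟨U, hU⟩, C, hC, hfC⟩
    refine ⟨fun j g => by simp [h1], ⟨U, fun u hu g => by simp [hU u hu]⟩, C, hC, ?_⟩
    exact (Function.support_const_smul_subset c f).trans hfC

theorem compactInductionSpace_translate (J : Subgroup G) (Λ : Representation ℂ J V) (x : G)
    (f : G → V) (hf : f ∈ compactInductionSpace J Λ) :
    (fun g => f (g * x)) ∈ compactInductionSpace J Λ := by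
  obtain ⟨h1, ⟨U, hU⟩, C, hC, hfC⟩ := hf
  refine ⟨fun j g => by simp [h1, mul_assoc], ?_, C * {x⁻¹}, hC.mul isCompact_singleton, ?_⟩
  · refine ⟨U.comap (MulAut.conj x⁻¹).toMonoidHom ?_, fun u hu g => ?_⟩
    · exact (continuous_const.mul continuous_id).mul continuous_const
    · have := hU (x⁻¹ * u * x) (by simpa using hu) (g * x)
      simpa [mul_assoc] using this
  · intro g hg
    obtain ⟨j, hj, c, hc, h⟩ := hfC (show g * x ∈ Function.support f from hg)
    refine ⟨j, hj, c * x⁻¹, ⟨c, hc, x⁻¹, rfl, rfl⟩, ?_⟩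
    simp only at h ⊢
    rw [← mul_assoc, h, mul_inv_cancel_right]

/-- The compactly induced representation `c-Ind_J^G Λ`: `G` acts by right translation. -/
def compactInduction (J : Subgroup G) (Λ : Representation ℂ J V) :
    Representation ℂ G (compactInductionSpace J Λ) where
  toFun x := (LinearMap.funLeft ℂ V (· * x)).restrict
    fun f hf => compactInductionSpace_translate J Λ x f hf
  map_one' := by ext; simp [LinearMap.funLeft]
  map_mul' x y := by ext; simp [LinearMap.funLeft, mul_assoc]

end CompactInduction

/-! ### Unitary representations, discrete series, formal dimension -/

/-- A (strongly continuous) unitary representation of `G` on the inner product space `H`. -/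
structure UnitaryRep (G : Type*) [Group G] [TopologicalSpace G]
    (H : Type*) [NormedAddCommGroup H] [InnerProductSpace ℂ H] where
  /-- the action -/
  toHom : G →* (H ≃ₗᵢ[ℂ] H)
  continuous_apply : ∀ u : H, Continuous fun g => toHom g u

namespace UnitaryRep

variable {G : Type*} [Group G] [TopologicalSpace G]
  {H : Type*} [NormedAddCommGroup H] [InnerProductSpace ℂ H]

/-- The only closed invariant subspaces are `0` and `H`, and `H ≠ 0`. -/
def IsIrreducible (π : UnitaryRep G H) : Prop :=
  Nontrivial H ∧ ∀ W : Submodule ℂ H, IsClosed (W : Set H) →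
    (∀ g, ∀ u ∈ W, π.toHom g u ∈ W) → W = ⊥ ∨ W = ⊤

/-- `π` is a completion of the representation `ρ`: `ρ` embeds `G`-equivariantly in `π` as a dense
subspace. -/
def IsCompletionOf (π : UnitaryRep G H) {E : Type*} [AddCommGroup E] [Module ℂ E]
    (ρ : Representation ℂ G E) : Prop :=
  ∃ ι : E →ₗ[ℂ] H, Function.Injective ι ∧ DenseRange ι ∧ ∀ g x, ι (ρ g x) = π.toHom g (ι x)

variable [MeasurableSpace (G ⧸ Subgroup.center G)]

/-- All matrix coefficients of `π` are square-integrable modulo the center `Z`: the function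
`|(π(g)u, v)|²` descends to an integrable function on `G/Z`. -/
def IsSquareIntegrableModCenter (π : UnitaryRep G H) (μ : Measure (G ⧸ Subgroup.center G)) :
    Prop :=
  ∀ u v : H, ∃ φ : G ⧸ Subgroup.center G → ℝ,
    (∀ g : G, φ (QuotientGroup.mk g) = ‖inner ℂ v (π.toHom g u)‖ ^ 2) ∧ Integrable φ μ

/-- Discrete series: irreducible unitary and square-integrable modulo the center. -/
def IsDiscreteSeries (π : UnitaryRep G H) (μ : Measure (G ⧸ Subgroup.center G)) : Prop :=
  π.IsIrreducible ∧ π.IsSquareIntegrableModCenter μ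

/-- `d > 0` is the formal dimension of `π` for the measure `μ` on `G/Z`, that is, Schur's relations
`∫_{G/Z} (π(g)u, v) conj (π(g)u', v') = d⁻¹ (u, u') conj (v, v')` hold (the integrand descends to
an integrable function on `G/Z`). Here `(a, b) = inner ℂ b a` is linear in `a`. -/
def HasFormalDimension (π : UnitaryRep G H) (μ : Measure (G ⧸ Subgroup.center G)) (d : ℝ) :
    Prop :=
  0 < d ∧ ∀ u v u' v' : H, ∃ φ : G ⧸ Subgroup.center G → ℂ,
    (∀ g : G, φ (QuotientGroup.mk g) =
      inner ℂ v (π.toHom g u) * conj (inner ℂ v' (π.toHom g u'))) ∧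
    Integrable φ μ ∧
    ∫ x, φ x ∂μ = (1 / (d : ℂ)) * (inner ℂ u' u * conj (inner ℂ v' v))

end UnitaryRep

/-! ### The depth-zero data in `GL(2, F)` -/

section LocalField

variable (F : Type*) [Field F] [ValuativeRel F]

/-- The inclusion `GL(2, 𝒪) → GL(2, F)`. -/
def integralGL2 : GL (Fin 2) 𝒪[F] →* GL (Fin 2) F :=
  GeneralLinearGroup.map (algebraMap 𝒪[F] F)

/-- The reduction map `GL(2, 𝒪) → GL(2, 𝓀)`, with `𝓀` the residue field. -/
def reductionGL2 : GL (Fin 2) 𝒪[F] →* GL (Fin 2) 𝓀[F] :=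
  GeneralLinearGroup.map (IsLocalRing.residue 𝒪[F])

/-- The subgroup `K = GL(2, 𝒪)` of `GL(2, F)`. -/
def maximalCompactGL2 : Subgroup (GL (Fin 2) F) := (integralGL2 F).range

/-- The subgroup `ZK` of `GL(2, F)`, where `Z` is the center. -/
def centerMaximalCompactGL2 : Subgroup (GL (Fin 2) F) :=
  Subgroup.center (GL (Fin 2) F) ⊔ maximalCompactGL2 F

variable {F}

/-- The restriction of `Λ` from `ZK` to `K` is the inflation of `Λ₀` along `K → GL(2, 𝓀)`. -/
def RestrictsToInflation {V : Type*} [AddCommGroup V] [Module ℂ V]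
    (Λ : Representation ℂ (centerMaximalCompactGL2 F) V)
    (Λ₀ : Representation ℂ (GL (Fin 2) 𝓀[F]) V) : Prop :=
  ∀ k : GL (Fin 2) 𝒪[F],
    Λ ⟨integralGL2 F k, Subgroup.mem_sup_right ⟨k, rfl⟩⟩ = Λ₀ (reductionGL2 F k)

/-- The center `Z` acts through `Λ` by the scalars `ω`, a unitary character of `Z`. -/
def HasUnitaryCentralCharacter {V : Type*} [AddCommGroup V] [Module ℂ V]
    (Λ : Representation ℂ (centerMaximalCompactGL2 F) V)
    (ω : Subgroup.center (GL (Fin 2) F) →* Circle) : Prop :=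
  ∀ z : Subgroup.center (GL (Fin 2) F),
    Λ ⟨z, Subgroup.mem_sup_left z.2⟩ = (ω z : ℂ) • LinearMap.id

end LocalField

end

/-! Write J = ZK, and let N be the group of upper unipotent matrices. After averaging an inner
product on V, the representation Λ has the properties collected in `IsIrreduciblyInducing`: it is
unitary and trivial on an open subgroup, only scalars commute with it, and no x outside J
intertwines it. Cuspidality gives the last property. By the Cartan decomposition x may be taken to
be diag(a, b) with |a| ≠ |b|. Conjugation by x or by its inverse then pushes N(𝒪) into the
congruence subgroup, where Λ is trivial, so an intertwiner absorbs the N-action on one side. It is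
therefore killed by the order of N over the residue field, because the sum over N acts by zero in a
cuspidal representation.

Translates of functions supported on J span the compact induction, so an invariant sesquilinear form
is determined by its values on pairs of such translates. These vanish for different cosets and are
given by Schur's lemma on a single coset. Hence invariant forms are unique up to a scalar
(`exists_invariantForm_eq`). Applied to the form defined by an orthogonal projection, this gives
irreducibility of any completion. Applied to the integral of a product of two matrix coefficients,
once in each pair of variables, it gives Schur's relations with an unknown constant c. The integrals
converge because these coefficients have compact support modulo Z, and the right invariance needed
is the unimodularity of G/Z.

Summing over an orthonormal basis of the copy of V supported on J gives c · dim V = vol(J/Z). A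
cuspidal representation has dimension q - 1: the N-eigenspace of the trivial character is zero, and
those of the q - 1 nontrivial characters are permuted by the diagonal group and are lines by the
Gelfand–Kazhdan anti-involution argument. So c = ((q - 1)/2)/(q - 1) = 1/2.

Fatou's lemma and continuity carry the relations from the dense subspace to the whole Hilbert space.
A completion exists inside the square-summable V-valued families on G/J. -/

/-! ### Elements of `GL(2)` -/

section Elements

variable {R : Type*} [CommRing R]

/-- The unipotent matrix `[1, x; 0, 1]`. -/
abbrev unipGL2 (x : R) : GL (Fin 2) R := GeneralLinearGroup.upperRightHom x

/-- The diagonal matrix `diag(a, b)`. -/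
def diagGL2 (a b : Rˣ) : GL (Fin 2) R :=
  ⟨!![(a : R), 0; 0, b], !![((a⁻¹ : Rˣ) : R), 0; 0, ((b⁻¹ : Rˣ) : R)],
    by simp [Matrix.one_fin_two], by simp [Matrix.one_fin_two]⟩

/-- The permutation matrix of size two. -/
def swapGL2 : GL (Fin 2) R :=
  ⟨!![0, 1; 1, 0], !![0, 1; 1, 0], by simp [Matrix.one_fin_two], by simp [Matrix.one_fin_two]⟩

@[simp] theorem coe_diagGL2 (a b : Rˣ) :
    (diagGL2 a b : Matrix (Fin 2) (Fin 2) R) = !![(a : R), 0; 0, b] := rfl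

@[simp] theorem coe_swapGL2 :
    ((swapGL2 : GL (Fin 2) R) : Matrix (Fin 2) (Fin 2) R) = !![0, 1; 1, 0] := rfl

theorem swapGL2_mul_swapGL2 : (swapGL2 : GL (Fin 2) R) * swapGL2 = 1 := by
  ext i j; fin_cases i <;> fin_cases j <;> simp

theorem diagGL2_mul (a b a' b' : Rˣ) :
    diagGL2 (a * a') (b * b') = diagGL2 a b * diagGL2 a' b' := by
  ext i j; fin_cases i <;> fin_cases j <;> simp

theorem diagGL2_one : (diagGL2 1 1 : GL (Fin 2) R) = 1 := by
  ext i j; fin_cases i <;> fin_cases j <;> simp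

theorem diagGL2_mul_unipGL2 (a b : Rˣ) (x : R) :
    diagGL2 a b * unipGL2 x = unipGL2 (a * x * (b⁻¹ : Rˣ)) * diagGL2 a b := by
  ext i j; fin_cases i <;> fin_cases j <;> simp

theorem swapGL2_mul_diagGL2_mul_swapGL2 (a b : Rˣ) :
    swapGL2 * diagGL2 a b * swapGL2 = diagGL2 b a := by
  ext i j; fin_cases i <;> fin_cases j <;> simp

theorem map_unipGL2 {S : Type*} [CommRing S] (f : R →+* S) (x : R) :
    GeneralLinearGroup.map f (unipGL2 x) = unipGL2 (f x) := by
  ext i j; fin_cases i <;> fin_cases j <;> simp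

theorem map_swapGL2 {S : Type*} [CommRing S] (f : R →+* S) :
    GeneralLinearGroup.map f swapGL2 = swapGL2 := by
  ext i j; fin_cases i <;> fin_cases j <;> simp

theorem diagGL2_self_mem_center (a : Rˣ) :
    diagGL2 a a ∈ Subgroup.center (GL (Fin 2) R) := by
  rw [Subgroup.mem_center_iff]
  intro g
  ext i j; fin_cases i <;> fin_cases j <;> simp [Matrix.mul_apply, Fin.sum_univ_two, mul_comm]

end Elements

/-! ### Common eigenvectors -/

/-- Induction on the dimension of `W`: if some operator is not scalar on `W`, its eigenspace in `W`
is nonzero, strictly smaller and stable under the others by commutation. The family may be infinite.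
-/
theorem exists_common_eigenvector {ι V : Type*} [AddCommGroup V] [Module ℂ V]
    [FiniteDimensional ℂ V] (f : ι → Module.End ℂ V) (hcomm : ∀ i j, Commute (f i) (f j))
    (W : Submodule ℂ V) (hW : W ≠ ⊥) (hf : ∀ i, ∀ v ∈ W, f i v ∈ W) :
    ∃ v ∈ W, v ≠ 0 ∧ ∀ i, ∃ c : ℂ, f i v = c • v := by
  induction hn : Module.finrank ℂ W using Nat.strong_induction_on generalizing W with
  | _ n ih =>
    by_cases h : ∀ i, ∃ c : ℂ, ∀ v ∈ W, f i v = c • v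
    · obtain ⟨v, hv, hv0⟩ := (Submodule.ne_bot_iff W).1 hW
      exact ⟨v, hv, hv0, fun i => (h i).imp fun c hc => hc v hv⟩
    · push Not at h
      obtain ⟨i, hi⟩ := h
      have : Nontrivial W := Submodule.nontrivial_iff_ne_bot.2 hW
      obtain ⟨c, hc⟩ := Module.End.exists_eigenvalue ((f i).restrict (hf i))
      obtain ⟨w, hw⟩ := hc.exists_hasEigenvector
      let W' : Submodule ℂ V := W ⊓ Module.End.eigenspace (f i) c
      have hlt : W' < W := by
        refine lt_of_le_of_ne inf_le_left fun h => ?_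
        obtain ⟨v, hv, hne⟩ := hi c
        have : v ∈ W' := h ▸ hv
        exact hne (Module.End.mem_eigenspace_iff.1 this.2)
      have hw' : (w : V) ∈ W' := by
        refine ⟨w.2, Module.End.mem_eigenspace_iff.2 ?_⟩
        exact congrArg Subtype.val hw.apply_eq_smul
      have hbot : W' ≠ ⊥ := by
        refine (Submodule.ne_bot_iff _).2 ⟨w, hw', ?_⟩
        simpa using hw.2
      have hinv : ∀ j, ∀ v ∈ W', f j v ∈ W' := by
        rintro j v ⟨hv, hv'⟩
        refine ⟨hf j v hv, Module.End.mem_eigenspace_iff.2 ?_⟩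
        have h1 : f i (f j v) = f j (f i v) := congrArg (fun T => T v) (hcomm i j).eq
        rw [h1, Module.End.mem_eigenspace_iff.1 hv', map_smul]
      obtain ⟨v, hv, h0, hv'⟩ := ih _ (hn ▸ Submodule.finrank_lt_finrank_of_lt hlt) W' hbot hinv rfl
      exact ⟨v, hv.1, h0, hv'⟩

/-! ### Cuspidal representations have no unipotent invariants -/

section Cuspidal

variable {k : Type*} [Field k] {V : Type*} [AddCommGroup V] [Module ℂ V]

theorem upperTriangularGL2_eq (b : upperTriangularGL2 k) :
    ∃ x : k, (b : GL (Fin 2) k) =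
      unipGL2 x * diagGL2 (diagonalPart k b).1 (diagonalPart k b).2 := by
  have h : (b : GL (Fin 2) k) 1 0 = 0 := b.2
  have h1 := (upperTriangularGL2_diag_ne_zero b).2
  refine ⟨(b : GL (Fin 2) k) 0 1 / (b : GL (Fin 2) k) 1 1, ?_⟩
  ext i j; fin_cases i <;> fin_cases j <;> simp [diagonalPart, h, h1]

/-- A functional that is fixed by the unipotent group and on which the diagonal group acts by
scalars gives an intertwining map to a principal series. -/
theorem not_isCuspidal_of_functional (ρ : Representation ℂ (GL (Fin 2) k) V)
    (l : V →ₗ[ℂ] ℂ) (hl : l ≠ 0) (hu : ∀ x v, l (ρ (unipGL2 x) v) = l v)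
    (hd : ∀ t : kˣ × kˣ, ∃ c : ℂ, ∀ v, l (ρ (diagGL2 t.1 t.2) v) = c * l v) :
    ¬ IsCuspidal ρ := by
  rintro ⟨hirr, hc⟩
  choose c hc' using hd
  obtain ⟨v0, hv0⟩ : ∃ v, l v ≠ 0 := by
    by_contra! h
    exact hl (LinearMap.ext h)
  let χ0 : kˣ × kˣ →* ℂ :=
    { toFun := c
      map_one' := by
        have := hc' 1 v0
        simp only [Prod.fst_one, Prod.snd_one, diagGL2_one, map_one, Module.End.one_apply] at this
        exact mul_right_cancel₀ hv0 (by rw [← this, one_mul])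
      map_mul' := fun s t => by
        have h1 := hc' (s * t) v0
        rw [Prod.fst_mul, Prod.snd_mul, diagGL2_mul, map_mul, Module.End.mul_apply, hc', hc'] at h1
        exact mul_right_cancel₀ hv0 (by rw [← h1, mul_assoc]) }
  let χ : kˣ × kˣ →* ℂˣ := χ0.toHomUnits
  -- Frobenius reciprocity: the functional `l` produces the map sending v to the function g ↦
  -- l(ρ(g)v).
  have hmem : ∀ v, (fun g => l (ρ g v)) ∈
      Representation.coindV (upperTriangularGL2 k).subtype (inflatedCharacter χ) := by
    intro v b g
    obtain ⟨x, hx⟩ := upperTriangularGL2_eq b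
    change l (ρ ((b : GL (Fin 2) k) * g) v) = c (diagonalPart k b) * l (ρ g v)
    rw [hx, mul_assoc, map_mul, Module.End.mul_apply, hu, map_mul, Module.End.mul_apply, hc']
  let f : ρ.IntertwiningMap (principalSeries χ) :=
    { toFun := fun v => ⟨fun g => l (ρ g v), hmem v⟩
      map_add' := fun v w => by ext g; simp
      map_smul' := fun a v => by ext g; simp
      isIntertwining' := fun g => by
        ext v h
        change l (ρ h (ρ g v)) = l (ρ (h * g) v)
        simp }
  rcases Representation.IsIrreducible.injective_or_eq_zero f with h | h
  · exact hc χ ⟨f, h⟩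
  · apply hv0
    have h1 : f v0 = 0 := by rw [h]; rfl
    have h2 : (f v0 : GL (Fin 2) k → ℂ) 1 = 0 := by rw [h1]; rfl
    change l (ρ 1 v0) = 0 at h2
    simpa using h2

variable [Fintype k]

/-- The sum of the unipotent group acts by zero in a cuspidal representation. -/
theorem IsCuspidal.sum_unipGL2 [FiniteDimensional ℂ V] {ρ : Representation ℂ (GL (Fin 2) k) V}
    (hρ : IsCuspidal ρ) : ∑ x : k, ρ (unipGL2 x) = 0 := by
  by_contra hne
  -- If the sum over N is nonzero, the space `W` of N-fixed functionals is nonzero. The diagonal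
  -- group normalizes N, so it preserves `W`, and its common eigenvector there contradicts
  -- cuspidality.
  let f : kˣ × kˣ → Module.End ℂ (Module.Dual ℂ V) := fun t =>
    Module.Dual.transpose (R := ℂ) (ρ (diagGL2 t.1 t.2))
  have hfa : ∀ t l v, f t l v = l (ρ (diagGL2 t.1 t.2) v) := fun t l v => rfl
  let W : Submodule ℂ (Module.Dual ℂ V) :=
    { carrier := {l | ∀ x v, l (ρ (unipGL2 x) v) = l v}
      add_mem' := fun {a b} ha hb x v => by
        rw [LinearMap.add_apply, LinearMap.add_apply, ha x v, hb x v]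
      zero_mem' := fun x v => by simp
      smul_mem' := fun c a ha x v => by
        rw [LinearMap.smul_apply, LinearMap.smul_apply, ha x v] }
  have hW : W ≠ ⊥ := by
    rw [Submodule.ne_bot_iff]
    obtain ⟨v, hv⟩ : ∃ v, (∑ x : k, ρ (unipGL2 x)) v ≠ 0 := by
      by_contra! h
      exact hne (LinearMap.ext h)
    obtain ⟨l, hl⟩ : ∃ l : Module.Dual ℂ V, l ((∑ x : k, ρ (unipGL2 x)) v) ≠ 0 := by
      by_contra! h
      exact hv ((Module.forall_dual_apply_eq_zero_iff ℂ _).1 h)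
    refine ⟨l ∘ₗ (∑ x : k, ρ (unipGL2 x)), fun y w => ?_, fun h => hl ?_⟩
    · have : (∑ x : k, ρ (unipGL2 x)) * ρ (unipGL2 y) = ∑ x : k, ρ (unipGL2 x) := by
        rw [Finset.sum_mul]
        refine Fintype.sum_equiv (Equiv.addRight y) _ _ fun x => ?_
        rw [← map_mul, ← AddChar.map_add_eq_mul]
        rfl
      exact congrArg l (congrArg (fun T => T w) this)
    · exact congrArg (fun T => T v) h
  obtain ⟨l, hl, hl0, hle⟩ := exists_common_eigenvector f (fun s t => by
    ext l v
    simp only [Module.End.mul_apply, hfa]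
    rw [← Module.End.mul_apply, ← Module.End.mul_apply, ← map_mul, ← map_mul, ← diagGL2_mul,
      ← diagGL2_mul, mul_comm s.1, mul_comm s.2]) W hW (fun t l hl x v => by
    rw [hfa, hfa, ← Module.End.mul_apply, ← map_mul, diagGL2_mul_unipGL2, map_mul,
      Module.End.mul_apply, hl])
  refine not_isCuspidal_of_functional ρ l hl0 hl (fun t => ?_) hρ
  obtain ⟨c, hc⟩ := hle t
  exact ⟨c, fun v => congrArg (fun T => T v) hc⟩

end Cuspidal

/-! ### The dimension of cuspidal representations -/

section Dimension

variable {k : Type*} [Field k] [Fintype k] {V : Type*} [AddCommGroup V] [Module ℂ V]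
  (ρ : Representation ℂ (GL (Fin 2) k) V) (ψ : AddChar k ℂ)

/-- The projection to the `ψ(a ·)`-eigenspace of the unipotent group. -/
noncomputable def whittakerProj (a : k) : Module.End ℂ V :=
  (Fintype.card k : ℂ)⁻¹ • ∑ x : k, ψ (-(a * x)) • ρ (unipGL2 x)

theorem card_field_ne_zero : (Fintype.card k : ℂ) ≠ 0 := by
  simp [Fintype.card_ne_zero]

theorem map_unipGL2_mul_whittakerProj (a y : k) :
    ρ (unipGL2 y) * whittakerProj ρ ψ a = ψ (a * y) • whittakerProj ρ ψ a := by
  rw [whittakerProj, mul_smul_comm, smul_comm]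
  congr 1
  rw [Finset.mul_sum, Finset.smul_sum]
  refine Fintype.sum_equiv (Equiv.addLeft y) _ _ fun x => ?_
  rw [mul_smul_comm, ← map_mul, ← AddChar.map_add_eq_mul, smul_smul, ← AddChar.map_add_eq_mul]
  simp only [Equiv.coe_addLeft]
  congr 2
  ring

theorem whittakerProj_mul_map_unipGL2 (a y : k) :
    whittakerProj ρ ψ a * ρ (unipGL2 y) = ψ (a * y) • whittakerProj ρ ψ a := by
  rw [whittakerProj, smul_mul_assoc, smul_comm]
  congr 1
  rw [Finset.sum_mul, Finset.smul_sum]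
  refine Fintype.sum_equiv (Equiv.addRight y) _ _ fun x => ?_
  rw [smul_mul_assoc, ← map_mul, ← AddChar.map_add_eq_mul, smul_smul, ← AddChar.map_add_eq_mul]
  simp only [Equiv.coe_addRight]
  congr 2
  ring

theorem whittakerProj_mul_self (a : k) :
    whittakerProj ρ ψ a * whittakerProj ρ ψ a = whittakerProj ρ ψ a := by
  conv_lhs => enter [1]; rw [whittakerProj]
  rw [smul_mul_assoc, Finset.sum_mul]
  simp_rw [smul_mul_assoc, map_unipGL2_mul_whittakerProj, smul_smul, ← AddChar.map_add_eq_mul,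
    neg_add_cancel, AddChar.map_zero_eq_one, one_smul]
  rw [Finset.sum_const, Finset.card_univ, ← Nat.cast_smul_eq_nsmul ℂ, smul_smul,
    inv_mul_cancel₀ card_field_ne_zero, one_smul]

/-- Fourier inversion on k: by orthogonality of characters only the term x = 0 survives the sum over
a. -/
theorem sum_whittakerProj (hψ : ψ.IsPrimitive) : ∑ a : k, whittakerProj ρ ψ a = 1 := by
  classical
  simp_rw [whittakerProj]
  rw [← Finset.smul_sum, Finset.sum_comm]
  simp_rw [← Finset.sum_smul]
  have h : ∀ x : k, ∑ a : k, ψ (-(a * x)) = if x = 0 then (Fintype.card k : ℂ) else 0 := by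
    intro x
    have := AddChar.sum_mulShift (R' := ℂ) (-x) hψ
    simp only [mul_neg, neg_eq_zero] at this
    rw [this]
    split_ifs <;> simp
  simp_rw [h, ite_smul, zero_smul]
  rw [Finset.sum_ite_eq' Finset.univ (0 : k), if_pos (Finset.mem_univ _), smul_smul,
    inv_mul_cancel₀ card_field_ne_zero, one_smul, unipGL2, AddChar.map_zero_eq_one, map_one]

theorem map_diagGL2_mul_whittakerProj (t : kˣ) :
    ρ (diagGL2 t 1) * whittakerProj ρ ψ t = whittakerProj ρ ψ 1 * ρ (diagGL2 t 1) := by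
  rw [whittakerProj, whittakerProj, mul_smul_comm, smul_mul_assoc, Finset.mul_sum, Finset.sum_mul]
  congr 1
  refine Fintype.sum_equiv (Units.mulLeft t) _ _ fun x => ?_
  rw [mul_smul_comm, smul_mul_assoc, ← map_mul, ← map_mul, diagGL2_mul_unipGL2]
  simp [Units.mulLeft]

/-- Conjugation by diag(t, 1) permutes the characters of N, so the eigenspaces of the nontrivial
ones all have the same dimension. -/
theorem trace_whittakerProj (t : kˣ) :
    LinearMap.trace ℂ V (whittakerProj ρ ψ t) = LinearMap.trace ℂ V (whittakerProj ρ ψ 1) := by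
  have h1 : ρ (diagGL2 t⁻¹ 1) * ρ (diagGL2 t 1) = 1 := by
    rw [← map_mul, ← diagGL2_mul, inv_mul_cancel, mul_one, diagGL2_one, map_one]
  have h2 : ρ (diagGL2 t 1) * ρ (diagGL2 t⁻¹ 1) = 1 := by
    rw [← map_mul, ← diagGL2_mul, mul_inv_cancel, mul_one, diagGL2_one, map_one]
  calc LinearMap.trace ℂ V (whittakerProj ρ ψ t)
      = LinearMap.trace ℂ V (ρ (diagGL2 t⁻¹ 1) * (ρ (diagGL2 t 1) * whittakerProj ρ ψ t)) := by
        rw [← mul_assoc, h1, one_mul]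
    _ = _ := by
        rw [map_diagGL2_mul_whittakerProj, LinearMap.trace_mul_comm, mul_assoc, h2, mul_one]

/-- The anti-involution `g ↦ w gᵀ w` of `GL(2)`. -/
def antiInvolutionGL2 (g : GL (Fin 2) k) : GL (Fin 2) k :=
  GeneralLinearGroup.mkOfDetNeZero !![g 1 1, g 0 1; g 1 0, g 0 0] (by
    have := ((Matrix.isUnit_iff_isUnit_det _).1 g.isUnit).ne_zero
    rw [Matrix.det_fin_two] at this ⊢
    simpa [mul_comm] using this)

omit [Fintype k] in
theorem antiInvolutionGL2_mul (g h : GL (Fin 2) k) :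
    antiInvolutionGL2 (g * h) = antiInvolutionGL2 h * antiInvolutionGL2 g := by
  ext i j; fin_cases i <;> fin_cases j <;>
    simp [antiInvolutionGL2, GeneralLinearGroup.mkOfDetNeZero, Matrix.mul_apply,
      Fin.sum_univ_two] <;> ring

omit [Fintype k] in
theorem antiInvolutionGL2_unipGL2 (x : k) : antiInvolutionGL2 (unipGL2 x) = unipGL2 x := by
  ext i j; fin_cases i <;> fin_cases j <;>
    simp [antiInvolutionGL2, GeneralLinearGroup.mkOfDetNeZero]

theorem unip_mul_apply (ρ : Representation ℂ (GL (Fin 2) k) V) (u v : k) (x : GL (Fin 2) k) :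
    whittakerProj ρ ψ 1 * ρ (unipGL2 u * x * unipGL2 v) * whittakerProj ρ ψ 1 =
      (ψ u * ψ v) • (whittakerProj ρ ψ 1 * ρ x * whittakerProj ρ ψ 1) := by
  rw [map_mul, map_mul, ← mul_assoc, ← mul_assoc, whittakerProj_mul_map_unipGL2, mul_assoc _ _
    (whittakerProj ρ ψ 1), map_unipGL2_mul_whittakerProj, one_mul, one_mul, smul_mul_assoc,
    smul_mul_assoc, mul_smul_comm, smul_smul]

/-- The Gelfand–Kazhdan argument over the Bruhat cells. The compression is ψ-equivariant under N on
both sides, so it suffices to treat double coset representatives: each is fixed by the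
anti-involution or has zero compression. -/
theorem whittakerProj_antiInvolutionGL2 (hψ : ψ.IsPrimitive) (x : GL (Fin 2) k) :
    whittakerProj ρ ψ 1 * ρ (antiInvolutionGL2 x) * whittakerProj ρ ψ 1 =
      whittakerProj ρ ψ 1 * ρ x * whittakerProj ρ ψ 1 := by
  by_cases hc : x 1 0 = 0
  · by_cases had : x 0 0 = x 1 1
    · congr 3
      ext i j; fin_cases i <;> fin_cases j <;>
        simp [antiInvolutionGL2, GeneralLinearGroup.mkOfDetNeZero, had]
    · have key : ∀ y : GL (Fin 2) k, y 1 0 = 0 → y 0 0 ≠ y 1 1 →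
          whittakerProj ρ ψ 1 * ρ y * whittakerProj ρ ψ 1 = 0 := by
        intro y hy hne
        have hd : y 1 1 ≠ 0 := (upperTriangularGL2_diag_ne_zero ⟨y, hy⟩).2
        have hne' : 1 - y 0 0 / y 1 1 ≠ 0 := by
          rw [sub_ne_zero, ne_comm, ne_eq, div_eq_one_iff_eq hd]
          exact hne
        -- Moving n(t) across y turns it into n(at/d), where a, d are the diagonal entries. Since a
        -- ≠ d, some t has ψ(t) ≠ ψ(at/d), and the two equivariances then force the compression to
        -- vanish.
        obtain ⟨t, ht⟩ := AddChar.ne_one_iff.1 (hψ hne')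
        rw [AddChar.mulShift_apply] at ht
        have h1 := unip_mul_apply ψ ρ 0 t y
        have h2 := unip_mul_apply ψ ρ (y 0 0 * t / y 1 1) 0 y
        have h3 : unipGL2 0 * y * unipGL2 t = unipGL2 (y 0 0 * t / y 1 1) * y * unipGL2 0 := by
          ext i j; fin_cases i <;> fin_cases j <;>
            simp [Matrix.mul_apply, Fin.sum_univ_two, hy]
          field_simp
          ring
        rw [h3, h2, AddChar.map_zero_eq_one, one_mul, mul_one] at h1
        by_contra h0
        apply ht
        have h4 : ψ (y 0 0 * t / y 1 1) = ψ t := smul_left_injective ℂ h0 h1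
        have : (1 - y 0 0 / y 1 1) * t = t + -(y 0 0 * t / y 1 1) := by ring
        rw [this, AddChar.map_add_eq_mul, ← h4, ← AddChar.map_add_eq_mul, add_neg_cancel,
          AddChar.map_zero_eq_one]
      rw [key x hc had, key _ _ _]
      · simpa [antiInvolutionGL2, GeneralLinearGroup.mkOfDetNeZero] using hc
      · simpa [antiInvolutionGL2, GeneralLinearGroup.mkOfDetNeZero] using Ne.symm had
  -- On the big cell the two unipotent factors clear the diagonal entries, and the anti-involution
  -- fixes antidiagonal matrices.
  · let y : GL (Fin 2) k := unipGL2 (-(x 0 0 / x 1 0)) * x * unipGL2 (-(x 1 1 / x 1 0))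
    have hx : x = unipGL2 (x 0 0 / x 1 0) * y * unipGL2 (x 1 1 / x 1 0) := by
      have h1 : unipGL2 (x 0 0 / x 1 0) * unipGL2 (-(x 0 0 / x 1 0)) = 1 := by
        rw [← AddChar.map_add_eq_mul, add_neg_cancel, AddChar.map_zero_eq_one]
      have h2 : unipGL2 (-(x 1 1 / x 1 0)) * unipGL2 (x 1 1 / x 1 0) = 1 := by
        rw [← AddChar.map_add_eq_mul, neg_add_cancel, AddChar.map_zero_eq_one]
      simp only [y]
      rw [← mul_assoc, ← mul_assoc, h1, one_mul, mul_assoc, h2, mul_one]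
    have hy : antiInvolutionGL2 y = y := by
      ext i j; fin_cases i <;> fin_cases j <;>
        simp [antiInvolutionGL2, GeneralLinearGroup.mkOfDetNeZero, y, Matrix.mul_apply,
          Fin.sum_univ_two, Matrix.vecMul, dotProduct, hc] <;> field_simp <;> ring
    clear_value y
    rw [hx, antiInvolutionGL2_mul, antiInvolutionGL2_mul, hy, antiInvolutionGL2_unipGL2,
      antiInvolutionGL2_unipGL2, ← mul_assoc, unip_mul_apply, unip_mul_apply, mul_comm (ψ _)]

/-- The compressions of group elements to a Whittaker eigenspace commute. -/
theorem whittaker_commute (hψ : ψ.IsPrimitive) (g h : GL (Fin 2) k) :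
    Commute (whittakerProj ρ ψ 1 * ρ g * whittakerProj ρ ψ 1)
      (whittakerProj ρ ψ 1 * ρ h * whittakerProj ρ ψ 1) := by
  -- Expanding the middle projection writes the product as an average of compressions of g n(x) h.
  -- The anti-involution reverses such a word and fixes n(x), which exchanges the roles of g and h.
  have key : ∀ g h : GL (Fin 2) k, (whittakerProj ρ ψ 1 * ρ g * whittakerProj ρ ψ 1) *
      (whittakerProj ρ ψ 1 * ρ h * whittakerProj ρ ψ 1) =
      (Fintype.card k : ℂ)⁻¹ • ∑ x : k, ψ (-x) • (whittakerProj ρ ψ 1 *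
        ρ (g * unipGL2 x * h) * whittakerProj ρ ψ 1) := by
    intro g h
    have h1 : (whittakerProj ρ ψ 1 * ρ g * whittakerProj ρ ψ 1) *
        (whittakerProj ρ ψ 1 * ρ h * whittakerProj ρ ψ 1) =
        (whittakerProj ρ ψ 1 * ρ g) * (whittakerProj ρ ψ 1 * whittakerProj ρ ψ 1) *
        (ρ h * whittakerProj ρ ψ 1) := by simp only [mul_assoc]
    rw [h1, whittakerProj_mul_self]
    conv_lhs => enter [1, 2]; rw [whittakerProj]
    rw [mul_smul_comm, smul_mul_assoc, Finset.mul_sum, Finset.sum_mul]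
    congr 1
    refine Finset.sum_congr rfl fun x _ => ?_
    rw [mul_smul_comm, smul_mul_assoc, one_mul, map_mul, map_mul]
    simp only [mul_assoc]
  rw [commute_iff_eq, key]
  conv_rhs => rw [← whittakerProj_antiInvolutionGL2 ρ ψ hψ h,
    ← whittakerProj_antiInvolutionGL2 ρ ψ hψ g, key]
  congr 1
  refine Finset.sum_congr rfl fun x _ => ?_
  rw [← whittakerProj_antiInvolutionGL2 ρ ψ hψ, antiInvolutionGL2_mul, antiInvolutionGL2_mul,
    antiInvolutionGL2_unipGL2, mul_assoc (antiInvolutionGL2 h)]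

/-- Multiplicity one: a nonzero Whittaker eigenspace of an irreducible representation is a line. -/
theorem finrank_range_whittakerProj_le [FiniteDimensional ℂ V] [ρ.IsIrreducible]
    (hψ : ψ.IsPrimitive) :
    Module.finrank ℂ (LinearMap.range (whittakerProj ρ ψ 1)) ≤ 1 := by
  set e := whittakerProj ρ ψ 1 with he
  have hee : ∀ v, e (e v) = e v := fun v =>
    congrArg (fun T => T v) (whittakerProj_mul_self ρ ψ 1)
  by_cases hW : LinearMap.range e = ⊥
  · rw [hW, finrank_bot]; exact zero_le_one
  obtain ⟨v, ⟨v', hv'⟩, hv0, hv⟩ := exists_common_eigenvector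
    (fun g => e * ρ g * e) (whittaker_commute ρ ψ hψ) _ hW (fun g w _ => ⟨_, rfl⟩)
  have hev : e v = v := by rw [← hv', hee]
  let S : Subrepresentation ρ :=
    { toSubmodule := Submodule.span ℂ (Set.range fun g => ρ g v)
      apply_mem_toSubmodule := fun g w hw => by
        have : Submodule.span ℂ (Set.range fun g => ρ g v) ≤
            (Submodule.span ℂ (Set.range fun g => ρ g v)).comap (ρ g) := by
          rw [Submodule.span_le]
          rintro _ ⟨h, rfl⟩
          refine Submodule.subset_span ⟨g * h, ?_⟩
          simp
        exact this hw }
  have hS : S = ⊤ := by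
    refine (eq_bot_or_eq_top S).resolve_left fun h => hv0 ?_
    have h1 : v ∈ S.toSubmodule := Submodule.subset_span ⟨1, by simp⟩
    rw [h] at h1
    exact h1
  refine finrank_le_one ⟨v, v', hv'⟩ fun ⟨w, w', hw'⟩ => ?_
  -- The vectors ρ(g)v span V by irreducibility, and e ρ(g) v = e ρ(g) e v is a multiple of v, so e
  -- maps V into the line of v.
  have hw : w ∈ (Submodule.span ℂ {v}).comap e := by
    have h1 : w ∈ S.toSubmodule := by rw [hS]; trivial
    refine (Submodule.span_le.2 ?_ : S.toSubmodule ≤ _) h1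
    rintro _ ⟨g, rfl⟩
    obtain ⟨c, hc⟩ := hv g
    refine Submodule.mem_span_singleton.2 ⟨c, ?_⟩
    rw [← hc, Module.End.mul_apply, Module.End.mul_apply, hev]
  rw [Submodule.mem_comap, ← hw', hee, hw'] at hw
  obtain ⟨c, hc⟩ := Submodule.mem_span_singleton.1 hw
  exact ⟨c, Subtype.ext hc⟩

/-- A cuspidal representation of `GL(2, 𝔽_q)` has dimension `q - 1`. -/
theorem IsCuspidal.finrank_eq [FiniteDimensional ℂ V] {ρ : Representation ℂ (GL (Fin 2) k) V}
    (hρ : IsCuspidal ρ) : (Module.finrank ℂ V : ℂ) = Fintype.card k - 1 := by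
  classical
  have := hρ.1
  have hV : Nontrivial V := by
    by_contra h
    rw [not_nontrivial_iff_subsingleton] at h
    obtain ⟨a, b, hab⟩ := exists_pair_ne (Subrepresentation ρ)
    exact hab (Subrepresentation.toSubmodule_injective (Subsingleton.elim _ _))
  obtain ⟨ψ, hψ⟩ := (AddChar.exists_apply_ne_zero (a := (1 : k))).2 one_ne_zero
  have hψ : ψ.IsPrimitive := AddChar.IsPrimitive.of_ne_one (fun h => hψ (by simp [h]))
  -- This projection averages over N, which acts by zero; only the q - 1 nonzero parameters
  -- contribute to the dimension.
  have h0 : whittakerProj ρ ψ 0 = 0 := by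
    rw [whittakerProj]
    simp only [zero_mul, neg_zero, AddChar.map_zero_eq_one, one_smul]
    rw [hρ.sum_unipGL2, smul_zero]
  set d := Module.finrank ℂ (LinearMap.range (whittakerProj ρ ψ 1)) with hd
  have htr : LinearMap.trace ℂ V (whittakerProj ρ ψ 1) = d :=
    LinearMap.IsProj.trace (LinearMap.IsIdempotentElem.isProj_range _
      (whittakerProj_mul_self ρ ψ 1))
  have hdim : (Module.finrank ℂ V : ℂ) = (Fintype.card k - 1) * d := by
    rw [← LinearMap.trace_one, ← sum_whittakerProj ρ ψ hψ, map_sum,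
      ← Finset.add_sum_erase _ _ (Finset.mem_univ (0 : k)), h0, map_zero, zero_add]
    have : ∀ a ∈ Finset.univ.erase (0 : k),
        LinearMap.trace ℂ V (whittakerProj ρ ψ a) = d := by
      intro a ha
      rw [← htr, ← trace_whittakerProj ρ ψ (Units.mk0 a (Finset.ne_of_mem_erase ha))]
      rfl
    rw [Finset.sum_congr rfl this, Finset.sum_const, Finset.card_erase_of_mem (Finset.mem_univ _),
      Finset.card_univ, nsmul_eq_mul, Nat.cast_sub Fintype.card_pos, Nat.cast_one]
  have hd1 : d = 1 := by
    refine le_antisymm (finrank_range_whittakerProj_le ρ ψ hψ) (Nat.one_le_iff_ne_zero.2 fun h => ?_)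
    rw [h, Nat.cast_zero, mul_zero, Nat.cast_eq_zero] at hdim
    exact Module.finrank_pos.ne' hdim
  rw [hdim, hd1, Nat.cast_one, mul_one]

end Dimension

/-! ### The group `GL(2, F)` over a local field: integrality and topology -/

section IntegralGroup

variable {F : Type*} [Field F] [ValuativeRel F]

theorem mem_maximalCompactGL2_iff {g : GL (Fin 2) F} :
    g ∈ maximalCompactGL2 F ↔
      (∀ i j, valuation F (g i j) ≤ 1) ∧
        valuation F (g : Matrix (Fin 2) (Fin 2) F).det = 1 := by
  constructor
  · rintro ⟨k, rfl⟩
    refine ⟨fun i j => (k i j).2, ?_⟩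
    have h1 : IsUnit (k : Matrix (Fin 2) (Fin 2) 𝒪[F]).det :=
      (Matrix.isUnit_iff_isUnit_det _).1 k.isUnit
    rw [(Valuation.integer.integers (valuation F)).isUnit_iff_valuation_eq_one] at h1
    rw [← h1, RingHom.map_det]
    rfl
  · rintro ⟨h1, h2⟩
    let A : Matrix (Fin 2) (Fin 2) 𝒪[F] := Matrix.of fun i j => ⟨g i j, h1 i j⟩
    have hA : (algebraMap 𝒪[F] F).mapMatrix A = g := by ext i j; rfl
    have hd : IsUnit A.det := by
      rw [(Valuation.integer.integers (valuation F)).isUnit_iff_valuation_eq_one, RingHom.map_det,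
        hA, h2]
    exact ⟨GeneralLinearGroup.mk'' A hd, by ext i j; rfl⟩

theorem swapGL2_mem_maximalCompactGL2 : (swapGL2 : GL (Fin 2) F) ∈ maximalCompactGL2 F :=
  ⟨swapGL2, map_swapGL2 _⟩

theorem unipGL2_mem_maximalCompactGL2 {x : F} (hx : valuation F x ≤ 1) :
    unipGL2 x ∈ maximalCompactGL2 F :=
  ⟨unipGL2 (⟨x, hx⟩ : 𝒪[F]), map_unipGL2 _ _⟩

theorem maximalCompactGL2_le : maximalCompactGL2 F ≤ centerMaximalCompactGL2 F := le_sup_right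

theorem center_le_centerMaximalCompactGL2 :
    Subgroup.center (GL (Fin 2) F) ≤ centerMaximalCompactGL2 F := le_sup_left

theorem diagGL2_mem_centerMaximalCompactGL2 {a b : Fˣ}
    (h : valuation F (a : F) = valuation F (b : F)) :
    diagGL2 a b ∈ centerMaximalCompactGL2 F := by
  have h1 : diagGL2 a b = diagGL2 b b * diagGL2 (b⁻¹ * a) 1 := by
    rw [← diagGL2_mul]; simp
  rw [h1]
  refine mul_mem (center_le_centerMaximalCompactGL2 (diagGL2_self_mem_center b))
    (maximalCompactGL2_le (mem_maximalCompactGL2_iff.2 ?_))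
  have hb : valuation F (b : F) ≠ 0 := (Valuation.ne_zero_iff _).2 b.ne_zero
  have h2 : valuation F ((b : F)⁻¹ * a) = 1 := by rw [map_mul, map_inv₀, h, inv_mul_cancel₀ hb]
  constructor
  · intro i j; fin_cases i <;> fin_cases j <;> simp [h, hb]
  · simp [Matrix.det_fin_two, h, hb]

/-- With a pivot of maximal valuation in the corner, row and column elimination uses integral
multipliers only. -/
theorem exists_cartan_of_le (g : GL (Fin 2) F)
    (h : ∀ i j, valuation F (g i j) ≤ valuation F (g 0 0)) :
    ∃ k ∈ maximalCompactGL2 F, ∃ k' ∈ maximalCompactGL2 F, ∃ a b : Fˣ,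
      g = k * diagGL2 a b * k' := by
  have hdet := ((Matrix.isUnit_iff_isUnit_det _).1 g.isUnit).ne_zero
  have h00 : g 0 0 ≠ 0 := by
    intro h0
    rw [h0, map_zero] at h
    have : ∀ i j, g i j = 0 := fun i j => (map_eq_zero _).1 (le_zero_iff.1 (h i j))
    rw [Matrix.det_fin_two, this, this 0 1] at hdet
    simp at hdet
  have hle : ∀ i j, valuation F (g i j / g 0 0) ≤ 1 := fun i j => by
    rw [map_div₀]
    exact div_le_one_of_le₀ (h i j) zero_le
  have hd : g 1 1 - g 0 1 * g 1 0 / g 0 0 ≠ 0 := by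
    intro h0
    rw [Matrix.det_fin_two] at hdet
    apply hdet
    field_simp at h0
    linear_combination h0
  -- Conjugating by the permutation matrix gives the lower unipotent with entry `g 1 0 / g 0 0`.
  refine ⟨swapGL2 * unipGL2 (g 1 0 / g 0 0) * swapGL2,
    mul_mem (mul_mem swapGL2_mem_maximalCompactGL2 (unipGL2_mem_maximalCompactGL2 (hle 1 0)))
      swapGL2_mem_maximalCompactGL2,
    unipGL2 (g 0 1 / g 0 0), unipGL2_mem_maximalCompactGL2 (hle 0 1),
    Units.mk0 _ h00, Units.mk0 _ hd, ?_⟩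
  ext i j; fin_cases i <;> fin_cases j <;>
    simp [Matrix.mul_apply, Fin.sum_univ_two] <;> field_simp
  ring

/-- The Cartan decomposition. -/
theorem exists_cartan (g : GL (Fin 2) F) :
    ∃ k ∈ maximalCompactGL2 F, ∃ k' ∈ maximalCompactGL2 F, ∃ a b : Fˣ,
      g = k * diagGL2 a b * k' := by
  obtain ⟨⟨i0, j0⟩, hmax⟩ := Finite.exists_max fun p : Fin 2 × Fin 2 => valuation F (g p.1 p.2)
  -- Integral permutations on both sides move an entry of maximal valuation to the corner.
  have hs : ∀ i0 : Fin 2, ∃ s ∈ maximalCompactGL2 F, s * s = 1 ∧ ∃ σ : Fin 2 → Fin 2, σ 0 = i0 ∧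
      ∀ g : GL (Fin 2) F, ∀ i j, (s * g) i j = g (σ i) j ∧ (g * s) j i = g j (σ i) := by
    intro i0
    fin_cases i0
    · exact ⟨1, one_mem _, one_mul 1, id, rfl, fun g i j => by simp⟩
    · refine ⟨swapGL2, swapGL2_mem_maximalCompactGL2, swapGL2_mul_swapGL2, ![1, 0], rfl, ?_⟩
      intro g i j
      fin_cases i <;> simp [Matrix.mul_apply, Fin.sum_univ_two]
  obtain ⟨s, hsK, hss, σ, hσ, hsg⟩ := hs i0
  obtain ⟨t, ht, htt, τ, hτ, htg⟩ := hs j0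
  obtain ⟨k, hk, k', hk', a, b, h⟩ := exists_cartan_of_le (s * g * t) (fun i j => by
    rw [(htg _ _ _).2, (htg _ _ _).2, (hsg _ _ _).1, (hsg _ _ _).1, hσ, hτ]
    exact hmax (σ i, τ j))
  refine ⟨s * k, mul_mem hsK hk, k' * t, mul_mem hk' ht, a, b, ?_⟩
  calc g = (s * s) * g * (t * t) := by rw [hss, htt]; simp
    _ = s * (s * g * t) * t := by simp only [mul_assoc]
    _ = _ := by rw [h]; simp only [mul_assoc]

theorem reductionGL2_surjective : Function.Surjective (reductionGL2 F) := by
  intro g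
  choose A hA using fun i j => IsLocalRing.residue_surjective (R := 𝒪[F]) (g i j)
  have hA' : (IsLocalRing.residue 𝒪[F]).mapMatrix (Matrix.of A) = g := by ext i j; exact hA i j
  have hd : IsUnit (Matrix.of A).det := by
    rw [← IsLocalRing.residue_ne_zero_iff_isUnit, RingHom.map_det, hA']
    exact ((Matrix.isUnit_iff_isUnit_det _).1 g.isUnit).ne_zero
  refine ⟨GeneralLinearGroup.mk'' (Matrix.of A) hd, ?_⟩
  ext i j
  exact hA i j

theorem residue_eq_zero_iff_valuation_lt_one (x : 𝒪[F]) :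
    IsLocalRing.residue 𝒪[F] x = 0 ↔ valuation F (x : F) < 1 := by
  rw [IsLocalRing.residue_eq_zero_iff, IsLocalRing.mem_maximalIdeal, mem_nonunits_iff,
    Valuation.Integer.not_isUnit_iff_valuation_lt_one]

variable (F) in
/-- The principal congruence subgroup of `GL(2, 𝒪)`. -/
noncomputable def congruenceGL2 : Subgroup (GL (Fin 2) F) := (reductionGL2 F).ker.map (integralGL2 F)

/-- Entries close to those of the identity force the determinant to be close to 1, hence a unit, so
integrality of the inverse comes for free. -/
theorem mem_congruenceGL2_of_valuation_lt {g : GL (Fin 2) F}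
    (h : ∀ i j, valuation F ((g : Matrix (Fin 2) (Fin 2) F) i j -
      (1 : Matrix (Fin 2) (Fin 2) F) i j) < 1) : g ∈ congruenceGL2 F := by
  have hg : ∀ i j, valuation F (g i j) ≤ 1 := by
    intro i j
    have h1 : valuation F ((1 : Matrix (Fin 2) (Fin 2) F) i j) ≤ 1 := by
      rw [Matrix.one_apply]; split_ifs <;> simp
    have := (valuation F).map_add_le (h i j).le h1
    rwa [sub_add_cancel] at this
  have hdet : valuation F (g : Matrix (Fin 2) (Fin 2) F).det = 1 := by
    have h00 := h 0 0
    have h01 := h 0 1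
    have h11 := h 1 1
    simp only [Matrix.one_apply, if_true, Fin.isValue, zero_ne_one, if_false, sub_zero] at h00 h01 h11
    have e1 : valuation F ((g 0 0 - 1) * g 1 1) < 1 := by
      rw [map_mul]; exact mul_lt_one_of_lt_of_le h00 (hg 1 1)
    have e2 : valuation F (g 0 1 * g 1 0) < 1 := by
      rw [map_mul]; exact mul_lt_one_of_lt_of_le h01 (hg 1 0)
    have e3 : valuation F ((g : Matrix (Fin 2) (Fin 2) F).det - 1) < valuation F 1 := by
      rw [map_one]
      have : (g : Matrix (Fin 2) (Fin 2) F).det - 1 =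
          ((g 0 0 - 1) * g 1 1 - g 0 1 * g 1 0) + (g 1 1 - 1) := by
        rw [Matrix.det_fin_two]; ring
      rw [this]
      exact (valuation F).map_add_lt ((valuation F).map_sub_lt e1 e2) h11
    rw [Valuation.map_eq_of_sub_lt _ e3, map_one]
  obtain ⟨k, rfl⟩ := mem_maximalCompactGL2_iff.2 ⟨hg, hdet⟩
  refine ⟨k, MonoidHom.mem_ker.2 ?_, rfl⟩
  ext i j
  have : IsLocalRing.residue 𝒪[F] (k i j - (1 : Matrix (Fin 2) (Fin 2) 𝒪[F]) i j) = 0 := by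
    rw [residue_eq_zero_iff_valuation_lt_one]
    convert h i j using 2
    by_cases hij : i = j
    · subst hij; simp [integralGL2]; rfl
    · simp [integralGL2, hij]; rfl
  rw [map_sub, sub_eq_zero] at this
  change IsLocalRing.residue 𝒪[F] (k i j) = _
  rw [this]
  by_cases hij : i = j
  · subst hij; simp
  · simp [hij]

theorem congruenceGL2_le : congruenceGL2 F ≤ maximalCompactGL2 F := by
  rintro _ ⟨k, -, rfl⟩
  exact ⟨k, rfl⟩

end IntegralGroup

/-! ### Open and compact subgroups of `GL(2, F)` -/

section Topology

variable (F : Type*) [Field F] [ValuativeRel F] [TopologicalSpace F] [IsNonarchimedeanLocalField F]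

instance instT2SpaceLocalField : T2Space F := by
  let := IsTopologicalAddGroup.rightUniformSpace F
  have := isUniformAddGroup_of_addCommGroup (G := F)
  infer_instance

theorem congruenceGL2_isOpen : IsOpen (congruenceGL2 F : Set (GL (Fin 2) F)) := by
  refine Subgroup.isOpen_of_mem_nhds _ (g := 1) ?_
  have hball : {x : F | valuation F x < 1} ∈ nhds (0 : F) :=
    (IsValuativeTopology.mem_nhds_zero_iff _).2 ⟨1, by simp⟩
  have : ∀ i j, ∀ᶠ g : GL (Fin 2) F in nhds 1,
      valuation F ((g : Matrix (Fin 2) (Fin 2) F) i j - (1 : Matrix (Fin 2) (Fin 2) F) i j) < 1 := by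
    intro i j
    have hc : Continuous fun g : GL (Fin 2) F =>
        (g : Matrix (Fin 2) (Fin 2) F) i j - (1 : Matrix (Fin 2) (Fin 2) F) i j :=
      (Units.continuous_val.matrix_elem i j).sub continuous_const
    have h0 := hc.tendsto 1
    simp only [Units.val_one, sub_self] at h0
    exact h0 hball
  have h2 : ∀ᶠ g : GL (Fin 2) F in nhds 1, ∀ i j,
      valuation F ((g : Matrix (Fin 2) (Fin 2) F) i j - (1 : Matrix (Fin 2) (Fin 2) F) i j) < 1 :=
    Filter.eventually_all.2 fun i => Filter.eventually_all.2 fun j => this i j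
  exact Filter.mem_of_superset h2 fun g hg => mem_congruenceGL2_of_valuation_lt hg

theorem maximalCompactGL2_isOpen : IsOpen (maximalCompactGL2 F : Set (GL (Fin 2) F)) :=
  Subgroup.isOpen_mono congruenceGL2_le (congruenceGL2_isOpen F)

theorem centerMaximalCompactGL2_isOpen :
    IsOpen (centerMaximalCompactGL2 F : Set (GL (Fin 2) F)) :=
  Subgroup.isOpen_mono maximalCompactGL2_le (maximalCompactGL2_isOpen F)

theorem maximalCompactGL2_isCompact : IsCompact (maximalCompactGL2 F : Set (GL (Fin 2) F)) := by
  have : CompactSpace (Matrix (Fin 2) (Fin 2) 𝒪[F]) :=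
    inferInstanceAs (CompactSpace (Fin 2 → Fin 2 → 𝒪[F]))
  have : CompactSpace (Matrix (Fin 2) (Fin 2) 𝒪[F])ᵐᵒᵖ :=
    MulOpposite.opHomeomorph.compactSpace
  -- Points being closed makes the unit group closed in the product of the matrix ring and its
  -- opposite, which is compact.
  have : T1Space (Matrix (Fin 2) (Fin 2) 𝒪[F]) :=
    inferInstanceAs (T1Space (Fin 2 → Fin 2 → 𝒪[F]))
  have : CompactSpace (GL (Fin 2) 𝒪[F]) := Units.isClosedEmbedding_embedProduct.compactSpace
  have hc : Continuous (integralGL2 F) :=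
    Continuous.units_map _ (continuous_id.matrix_map continuous_subtype_val)
  have := isCompact_range hc
  rwa [← MonoidHom.coe_range] at this

instance instLocallyCompactSpaceGL2 : LocallyCompactSpace (GL (Fin 2) F) :=
  (maximalCompactGL2_isCompact F).locallyCompactSpace_of_mem_nhds_of_group
    ((maximalCompactGL2_isOpen F).mem_nhds (one_mem _))

end Topology

/-! ### The inducing representation -/

section Inducing

variable {F : Type*} [Field F] [ValuativeRel F] {V : Type*} [AddCommGroup V] [Module ℂ V]
  {Λ₀ : Representation ℂ (GL (Fin 2) 𝓀[F]) V}
  {Λ : Representation ℂ (centerMaximalCompactGL2 F) V}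

theorem exists_eq_center_mul_integralGL2 (j : centerMaximalCompactGL2 F) :
    ∃ (z : Subgroup.center (GL (Fin 2) F)) (k : GL (Fin 2) 𝒪[F]),
      j = ⟨z, center_le_centerMaximalCompactGL2 z.2⟩ *
        ⟨integralGL2 F k, maximalCompactGL2_le ⟨k, rfl⟩⟩ := by
  obtain ⟨z, hz, _, ⟨k, rfl⟩, h⟩ := Subgroup.mem_sup_of_normal_left.1 j.2
  exact ⟨⟨z, hz⟩, k, Subtype.ext h.symm⟩

theorem RestrictsToInflation.apply_congruence (hΛ : RestrictsToInflation Λ Λ₀)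
    (g : GL (Fin 2) F) (hg : g ∈ congruenceGL2 F) :
    Λ ⟨g, maximalCompactGL2_le (congruenceGL2_le hg)⟩ = 1 := by
  obtain ⟨k, hk, rfl⟩ := hg
  rw [hΛ k, MonoidHom.mem_ker.1 hk, map_one]

/-- Schur's lemma for the inducing representation. -/
theorem RestrictsToInflation.exists_eq_smul_id [FiniteDimensional ℂ V]
    (hΛ₀ : IsCuspidal Λ₀) (hΛ : RestrictsToInflation Λ Λ₀)
    (T : V →ₗ[ℂ] V) (hT : ∀ j, T ∘ₗ Λ j = Λ j ∘ₗ T) : ∃ c : ℂ, T = c • LinearMap.id := by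
  have := hΛ₀.1
  let f : Λ₀.IntertwiningMap Λ₀ :=
    { T with
      isIntertwining' := fun g => by
        -- Reduction is surjective, so commuting with Λ on K is commuting with all of Λ₀.
        obtain ⟨k, rfl⟩ := reductionGL2_surjective g
        rw [← hΛ k]
        exact hT _ }
  obtain ⟨c, hc⟩ :=
    (Representation.IsIrreducible.algebraMap_intertwiningMap_bijective_of_isAlgClosed
      (ρ := Λ₀)).2 f
  refine ⟨c, ?_⟩
  ext v
  exact congrArg (fun f : Λ₀.IntertwiningMap Λ₀ => f v) hc.symm

/-- An operator fixed by the reductions of all unipotent matrices vanishes, on either side. -/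
theorem RestrictsToInflation.eq_zero_of_unip [Finite 𝓀[F]] [FiniteDimensional ℂ V]
    (hΛ₀ : IsCuspidal Λ₀) (T : V →ₗ[ℂ] V)
    (h : (∀ x : 𝒪[F], T ∘ₗ Λ₀ (reductionGL2 F (unipGL2 x)) = T) ∨
      (∀ x : 𝒪[F], Λ₀ (reductionGL2 F (unipGL2 x)) ∘ₗ T = T)) : T = 0 := by
  have := Fintype.ofFinite 𝓀[F]
  have hc : (Fintype.card 𝓀[F] : ℂ) ≠ 0 := card_field_ne_zero
  have hsum := hΛ₀.sum_unipGL2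
  -- Sum the invariance over the residue field: the sum over N appears as a factor and is zero.
  have key : (Fintype.card 𝓀[F] : ℂ) • T = 0 := by
    rcases h with h | h
    · have : ∑ x : 𝓀[F], T * Λ₀ (unipGL2 x) = (Fintype.card 𝓀[F] : ℂ) • T := by
        rw [Finset.sum_congr rfl (g := fun _ => T), Finset.sum_const, Finset.card_univ,
          Nat.cast_smul_eq_nsmul]
        intro y _
        obtain ⟨x, rfl⟩ := IsLocalRing.residue_surjective y
        rw [← map_unipGL2]
        exact h x
      rw [← this, ← Finset.mul_sum, hsum, mul_zero]
    · have : ∑ x : 𝓀[F], Λ₀ (unipGL2 x) * T = (Fintype.card 𝓀[F] : ℂ) • T := by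
        rw [Finset.sum_congr rfl (g := fun _ => T), Finset.sum_const, Finset.card_univ,
          Nat.cast_smul_eq_nsmul]
        intro y _
        obtain ⟨x, rfl⟩ := IsLocalRing.residue_surjective y
        rw [← map_unipGL2]
        exact h x
      rw [← this, ← Finset.sum_mul, hsum, zero_mul]
  exact (smul_eq_zero.1 key).resolve_left hc

theorem unipGL2_mem_congruenceGL2 {x : F} (hx : valuation F x < 1) :
    unipGL2 x ∈ congruenceGL2 F :=
  ⟨unipGL2 (⟨x, hx.le⟩ : 𝒪[F]), MonoidHom.mem_ker.2 (by
    rw [reductionGL2, map_unipGL2, (residue_eq_zero_iff_valuation_lt_one _).2 hx]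
    exact AddChar.map_zero_eq_one _), map_unipGL2 _ _⟩

/-- Elements outside of `ZK` do not intertwine the inducing representation. -/
theorem RestrictsToInflation.intertwiner_eq_zero [Finite 𝓀[F]] [FiniteDimensional ℂ V]
    (hΛ₀ : IsCuspidal Λ₀) (hΛ : RestrictsToInflation Λ Λ₀)
    (x : GL (Fin 2) F) (hx : x ∉ centerMaximalCompactGL2 F) (T : V →ₗ[ℂ] V)
    (hT : ∀ j j' : centerMaximalCompactGL2 F, x * j = j' * x → T ∘ₗ Λ j = Λ j' ∘ₗ T) :
    T = 0 := by
  obtain ⟨k, hk, k', hk', a, b, rfl⟩ := exists_cartan x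
  lift k to centerMaximalCompactGL2 F using maximalCompactGL2_le hk
  lift k' to centerMaximalCompactGL2 F using maximalCompactGL2_le hk'
  have hab : valuation F (a : F) ≠ valuation F (b : F) := fun h =>
    hx (mul_mem (mul_mem k.2 (diagGL2_mem_centerMaximalCompactGL2 h)) k'.2)
  have ha : valuation F (a : F) ≠ 0 := (Valuation.ne_zero_iff _).2 a.ne_zero
  have hb : valuation F (b : F) ≠ 0 := (Valuation.ne_zero_iff _).2 b.ne_zero
  -- Removing the two compact factors turns an intertwiner for x into one for diag(a, b).
  let T' : V →ₗ[ℂ] V := Λ k⁻¹ * T * Λ k'⁻¹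
  have hT' : ∀ j j' : centerMaximalCompactGL2 F, diagGL2 a b * j = j' * diagGL2 a b →
      T' * Λ j = Λ j' * T' := by
    intro j j' h
    have h1 := hT (k'⁻¹ * j * k') (k * j' * k⁻¹) (by
      simp only [Subgroup.coe_mul, Subgroup.coe_inv]
      calc (k : GL (Fin 2) F) * diagGL2 a b * k' * ((k' : GL (Fin 2) F)⁻¹ * j * k')
          = k * (diagGL2 a b * j) * k' := by group
        _ = _ := by rw [h]; group)
    change T * _ = _ * T at h1
    simp only [map_mul] at h1
    have e1 : Λ k'⁻¹ * Λ j = (Λ k'⁻¹ * Λ j * Λ k') * Λ k'⁻¹ := by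
      rw [mul_assoc _ (Λ k'), ← map_mul Λ k', mul_inv_cancel, map_one, mul_one]
    have e2 : Λ k⁻¹ * (Λ k * Λ j' * Λ k⁻¹) = Λ j' * Λ k⁻¹ := by
      rw [← mul_assoc, ← mul_assoc, ← map_mul, inv_mul_cancel, map_one, one_mul]
    simp only [T']
    rw [mul_assoc, e1, ← mul_assoc, mul_assoc (Λ k⁻¹), h1, ← mul_assoc (Λ k⁻¹), e2]
    simp only [mul_assoc]
  have hT0 : T' = 0 := by
    refine RestrictsToInflation.eq_zero_of_unip hΛ₀ T' ?_
    rcases lt_or_gt_of_ne hab with h | h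
    -- Here n(x) becomes n(ax/b) with |ax/b| < 1, which Λ does not see, so `T'` absorbs the
    -- unipotents on the right. In the other case the inverse conjugation contracts, and they are
    -- absorbed on the left.
    · refine Or.inl fun x => ?_
      have hv : valuation F (a * x * (b⁻¹ : Fˣ)) < 1 := by
        rw [map_mul, map_mul, Units.val_inv_eq_inv_val, map_inv₀, mul_right_comm,
          ← div_eq_mul_inv]
        exact mul_lt_one_of_lt_of_le ((div_lt_one₀ (zero_lt_iff.2 hb)).2 h) x.2
      have hm := unipGL2_mem_congruenceGL2 hv
      have h1 := hT' ⟨integralGL2 F (unipGL2 x), maximalCompactGL2_le ⟨_, rfl⟩⟩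
        ⟨_, maximalCompactGL2_le (congruenceGL2_le hm)⟩ (by
          simp only [integralGL2, map_unipGL2]
          exact diagGL2_mul_unipGL2 a b _)
      rw [hΛ.apply_congruence _ hm, one_mul, hΛ] at h1
      exact h1
    · refine Or.inr fun x => ?_
      have hv : valuation F (b * x * (a⁻¹ : Fˣ)) < 1 := by
        rw [map_mul, map_mul, Units.val_inv_eq_inv_val, map_inv₀, mul_right_comm,
          ← div_eq_mul_inv]
        exact mul_lt_one_of_lt_of_le ((div_lt_one₀ (zero_lt_iff.2 ha)).2 h) x.2
      have hm := unipGL2_mem_congruenceGL2 hv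
      have h1 := hT' ⟨_, maximalCompactGL2_le (congruenceGL2_le hm)⟩
        ⟨integralGL2 F (unipGL2 x), maximalCompactGL2_le ⟨_, rfl⟩⟩ (by
          simp only [integralGL2, map_unipGL2]
          rw [diagGL2_mul_unipGL2]
          congr 2
          simp only [Units.val_inv_eq_inv_val]
          field_simp
          rfl)
      rw [hΛ.apply_congruence _ hm, mul_one, hΛ] at h1
      exact h1.symm
  have : T = Λ k * T' * Λ k' := by
    simp only [T']
    rw [mul_assoc, mul_assoc, mul_assoc, ← map_mul Λ, inv_mul_cancel, map_one, mul_one, ← mul_assoc,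
      ← map_mul Λ, mul_inv_cancel, map_one, one_mul]
  rw [this, hT0, mul_zero, zero_mul]

/-- The inducing representation is unitarizable. -/
theorem RestrictsToInflation.exists_invariant_core [Finite 𝓀[F]] [FiniteDimensional ℂ V]
    (hΛ : RestrictsToInflation Λ Λ₀) {ω : Subgroup.center (GL (Fin 2) F) →* Circle}
    (hω : HasUnitaryCentralCharacter Λ ω) :
    ∃ c : InnerProductSpace.Core ℂ V, ∀ j v w, c.inner (Λ j v) (Λ j w) = c.inner v w := by
  have := Fintype.ofFinite (GL (Fin 2) 𝓀[F])
  let e : V ≃ₗ[ℂ] EuclideanSpace ℂ (Fin (Module.finrank ℂ V)) :=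
    LinearEquiv.ofFinrankEq _ _ (by simp)
  -- Averaging over the finite group suffices, since K acts through it and Z acts by scalars of
  -- absolute value one.
  let h : V → V → ℂ := fun v w => ∑ g, inner ℂ (e (Λ₀ g v)) (e (Λ₀ g w))
  have hre : ∀ v, RCLike.re (h v v) = ∑ g, ‖e (Λ₀ g v)‖ ^ 2 := fun v => by
    simp only [h, map_sum]
    exact Finset.sum_congr rfl fun g _ => inner_self_eq_norm_sq _
  refine ⟨{ inner := h
            conj_inner_symm := fun v w => by simp [h]
            re_inner_nonneg := fun v => by
              rw [hre]; positivity
            add_left := fun u v w => by simp [h, Finset.sum_add_distrib]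
            smul_left := fun v w c => by simp [h, Finset.mul_sum, mul_comm]
            definite := fun v hv => ?_ }, ?_⟩
  · have h1 := hre v
    change h v v = 0 at hv
    rw [hv, map_zero] at h1
    have h2 := (Finset.sum_eq_zero_iff_of_nonneg fun g _ => by positivity).1 h1.symm 1
      (Finset.mem_univ _)
    simpa using h2
  · intro j v w
    obtain ⟨z, k, rfl⟩ := exists_eq_center_mul_integralGL2 j
    change h _ _ = h v w
    have hk : ∀ v w, h (Λ₀ (reductionGL2 F k) v) (Λ₀ (reductionGL2 F k) w) = h v w := by
      intro v w
      refine Fintype.sum_equiv (Equiv.mulRight (reductionGL2 F k)) _ _ fun g => ?_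
      simp
    have hz : ∀ (c : Circle) v w, h ((c : ℂ) • v) ((c : ℂ) • w) = h v w := by
      intro c v w
      simp only [h, map_smul, inner_smul_left, inner_smul_right]
      refine Finset.sum_congr rfl fun g _ => ?_
      rw [← mul_assoc, mul_comm (c : ℂ), ← Complex.normSq_eq_conj_mul_self]
      simp
    rw [map_mul, hω z, Module.End.mul_apply, Module.End.mul_apply, hΛ k]
    simp only [LinearMap.smul_apply, LinearMap.id_apply]
    rw [hz, hk]

end Inducing

/-! ### Compact induction: generators and completions -/

section CompactInductionGenerators

variable {G : Type*} [Group G] [TopologicalSpace G] [IsTopologicalGroup G]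
  {V : Type*} [AddCommGroup V] [Module ℂ V] {J : Subgroup G} {Λ : Representation ℂ J V}

/-- The representation `Λ` of `J` is trivial on an open subgroup of `G`. -/
def IsTrivialOnOpen (Λ : Representation ℂ J V) : Prop :=
  ∃ (U : OpenSubgroup G) (h : (U : Subgroup G) ≤ J), ∀ (u : G) (hu : u ∈ U), Λ ⟨u, h hu⟩ = 1

theorem IsTrivialOnOpen.isOpen (h : IsTrivialOnOpen Λ) : IsOpen (J : Set G) := by
  obtain ⟨U, hU, -⟩ := h
  exact Subgroup.isOpen_mono hU U.isOpen

omit [IsTopologicalGroup G] in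
open Classical in
theorem extendByZero_mem (hΛ : IsTrivialOnOpen Λ) (v : V) :
    (fun g => if h : g ∈ J then Λ ⟨g, h⟩ v else 0) ∈ compactInductionSpace J Λ := by
  obtain ⟨U, hUJ, hU⟩ := hΛ
  refine ⟨fun j g => ?_, ⟨U, fun u hu g => ?_⟩, {1}, isCompact_singleton, fun g hg => ?_⟩
  · beta_reduce
    by_cases hg : g ∈ J
    · rw [dif_pos hg, dif_pos (mul_mem j.2 hg), ← Module.End.mul_apply, ← map_mul]
      rfl
    · rw [dif_neg hg, dif_neg (fun h => hg ((Subgroup.mul_mem_cancel_left J j.2).1 h)), map_zero]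
  · beta_reduce
    by_cases hg : g ∈ J
    · rw [dif_pos hg, dif_pos (mul_mem hg (hUJ hu))]
      have : (⟨g * u, mul_mem hg (hUJ hu)⟩ : J) = ⟨g, hg⟩ * ⟨u, hUJ hu⟩ := rfl
      rw [this, map_mul, hU u hu, mul_one]
    · rw [dif_neg hg, dif_neg (fun h => hg ((Subgroup.mul_mem_cancel_right J (hUJ hu)).1 h))]
  · by_cases h : g ∈ J
    · exact ⟨g, h, 1, rfl, mul_one g⟩
    · exact absurd (dif_neg h) hg

open Classical in
/-- The functions in `c-Ind_J^G Λ` that are supported on `J`. -/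
noncomputable def extendByZero (hΛ : IsTrivialOnOpen Λ) : V →ₗ[ℂ] compactInductionSpace J Λ where
  toFun v := ⟨fun g => if h : g ∈ J then Λ ⟨g, h⟩ v else 0, extendByZero_mem hΛ v⟩
  map_add' v w := by
    ext g
    by_cases hg : g ∈ J <;> simp [hg]
  map_smul' c v := by
    ext g
    by_cases hg : g ∈ J <;> simp [hg]

omit [IsTopologicalGroup G] in
theorem extendByZero_apply (hΛ : IsTrivialOnOpen Λ) (v : V) (j : J) :
    (extendByZero hΛ v : G → V) j = Λ j v :=
  dif_pos j.2

omit [IsTopologicalGroup G] in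
theorem extendByZero_apply_of_notMem (hΛ : IsTrivialOnOpen Λ) (v : V) {g : G} (hg : g ∉ J) :
    (extendByZero hΛ v : G → V) g = 0 :=
  dif_neg hg

theorem compactInduction_apply (x : G) (f : compactInductionSpace J Λ) (g : G) :
    (compactInduction J Λ x f : G → V) g = (f : G → V) (g * x) := rfl

omit [IsTopologicalGroup G] in
theorem extendByZero_injective (hΛ : IsTrivialOnOpen Λ) : Function.Injective (extendByZero hΛ) := by
  intro v w h
  have h1 := extendByZero_apply hΛ v 1
  rw [h, extendByZero_apply, map_one] at h1
  exact h1.symm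

theorem compactInduction_extendByZero (hΛ : IsTrivialOnOpen Λ) (j : J) (v : V) :
    compactInduction J Λ j (extendByZero hΛ v) = extendByZero hΛ (Λ j v) := by
  ext g
  rw [compactInduction_apply]
  by_cases hg : g ∈ J
  · have h1 := extendByZero_apply hΛ v (⟨g, hg⟩ * j)
    have h2 := extendByZero_apply hΛ (Λ j v) ⟨g, hg⟩
    rw [map_mul] at h1
    exact h1.trans h2.symm
  · rw [extendByZero_apply_of_notMem hΛ _ hg, extendByZero_apply_of_notMem hΛ _
      (fun h => hg ((Subgroup.mul_mem_cancel_right J j.2).1 h))]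

-- Equivariance on the left concerns J\G; inversion moves it to G/J. Up to an operator of Λ, the
-- value at the inverse of g depends only on the coset gJ.
omit [IsTopologicalGroup G] in
theorem apply_inv_eq (f : compactInductionSpace J Λ) (g : G) :
    ∃ j : J, (f : G → V) g⁻¹ = Λ j ((f : G → V) ((QuotientGroup.mk g : G ⧸ J).out)⁻¹) := by
  obtain ⟨h, hh⟩ := QuotientGroup.mk_out_eq_mul J g
  refine ⟨h, ?_⟩
  rw [← f.2.1, hh, _root_.mul_inv_rev, mul_inv_cancel_left]

/-- As J is open, G/J is discrete, and the compact image of the support is finite. -/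
theorem finite_support_compactInduction (hJ : IsOpen (J : Set G))
    (f : compactInductionSpace J Λ) :
    {q : G ⧸ J | (f : G → V) (q.out)⁻¹ ≠ 0}.Finite := by
  have := QuotientGroup.discreteTopology hJ
  obtain ⟨C, hC, hfC⟩ := f.2.2.2
  have h1 : IsCompact ((QuotientGroup.mk : G → G ⧸ J) '' C⁻¹) :=
    hC.inv.image QuotientGroup.continuous_mk
  refine (isCompact_iff_finite.1 h1).subset fun q hq => ?_
  obtain ⟨j, hj, c, hc, h⟩ := hfC hq
  refine ⟨c⁻¹, by simpa using hc, ?_⟩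
  rw [← QuotientGroup.out_eq' q, QuotientGroup.eq, inv_inv]
  have h2 : q.out = c⁻¹ * j⁻¹ := by rw [← _root_.mul_inv_rev, ← _root_.inv_inj, inv_inv]; exact h.symm
  rw [h2, mul_inv_cancel_left]
  exact inv_mem hj

/-- The functions supported on `J` generate `c-Ind_J^G Λ`. -/
theorem span_extendByZero (hΛ : IsTrivialOnOpen Λ) :
    Submodule.span ℂ (Set.range fun p : G × V =>
      compactInduction J Λ p.1 (extendByZero hΛ p.2)) = ⊤ := by
  rw [Submodule.eq_top_iff']
  intro f
  let S := (finite_support_compactInduction hΛ.isOpen f).toFinset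
  -- A function is the sum of its restrictions to cosets of J, each a translate of a function
  -- supported on J; at g only the coset of g⁻¹ contributes.
  have hf : f = ∑ q ∈ S, compactInduction J Λ q.out
      (extendByZero hΛ ((f : G → V) (q.out)⁻¹)) := by
    ext g
    rw [AddSubmonoidClass.coe_finsetSum, Finset.sum_apply]
    simp only [compactInduction_apply]
    rw [Finset.sum_eq_single (QuotientGroup.mk g⁻¹ : G ⧸ J)]
    · obtain ⟨h, hh⟩ := QuotientGroup.mk_out_eq_mul J g⁻¹
      rw [hh, mul_inv_cancel_left, extendByZero_apply, ← f.2.1, _root_.mul_inv_rev, inv_inv,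
        mul_inv_cancel_left]
    · intro q _ hq
      refine extendByZero_apply_of_notMem hΛ _ fun h => hq ?_
      rw [← QuotientGroup.out_eq' q, eq_comm, QuotientGroup.eq, inv_inv]
      exact h
    · intro h
      have h0 : (f : G → V) ((QuotientGroup.mk g⁻¹ : G ⧸ J).out)⁻¹ = 0 := by
        by_contra h1
        exact h ((Set.Finite.mem_toFinset _).2 h1)
      rw [h0, map_zero]
      rfl
  rw [hf]
  exact Submodule.sum_mem _ fun q _ => Submodule.subset_span ⟨(q.out, _), rfl⟩

end CompactInductionGenerators

/-! ### Existence of a unitary completion -/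

section Existence

/-- An isometric representation on a dense subspace with continuous orbit maps extends to a
unitary representation. -/
theorem exists_unitaryRep_of_dense {G : Type*} [Group G] [TopologicalSpace G]
    {H : Type*} [NormedAddCommGroup H] [InnerProductSpace ℂ H] [CompleteSpace H]
    {E : Type*} [AddCommGroup E] [Module ℂ E] (ρ : Representation ℂ G E) (e : E →ₗ[ℂ] H)
    (he : DenseRange e) (hnorm : ∀ g x, ‖e (ρ g x)‖ = ‖e x‖)
    (hcont : ∀ x, Continuous fun g => e (ρ g x)) :
    ∃ π : UnitaryRep G H, ∀ g x, π.toHom g (e x) = e (ρ g x) := by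
  let r : G → (E ≃ₗ[ℂ] E) := fun g =>
    LinearEquiv.ofLinearMap (ρ g) (ρ g⁻¹)
      (by rw [← Module.End.mul_eq_comp, ← map_mul, mul_inv_cancel, map_one]; rfl)
      (by rw [← Module.End.mul_eq_comp, ← map_mul, inv_mul_cancel, map_one]; rfl)
  let A : G → (H ≃ₗᵢ[ℂ] H) := fun g => (r g).extendOfIsometry e e he he (hnorm g)
  have hA : ∀ g x, A g (e x) = e (ρ g x) := fun g x =>
    LinearEquiv.extendOfIsometry_eq (r g) e e he he (hnorm g) x
  have hext : ∀ B C : H ≃ₗᵢ[ℂ] H, (∀ x, B (e x) = C (e x)) → B = C := fun B C h => by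
    ext u
    exact he.induction_on (p := fun u => B u = C u) u (isClosed_eq B.continuous C.continuous) h
  refine ⟨{ toHom := { toFun := A
                       map_one' := hext _ _ fun x => by rw [hA, map_one]; rfl
                       map_mul' := fun g h => hext _ _ fun x => by
                        
                          change A (g * h) (e x) = A g (A h (e x))
                          rw [hA, hA, hA, map_mul]; rfl }
            continuous_apply := fun u => ?_ }, hA⟩
  rw [continuous_iff_continuousAt]
  intro g₀
  rw [Metric.continuousAt_iff']
  intro ε hε
  -- Strong continuity passes to the limit because all operators are isometries: approximate u
  -- within ε/3 by a vector with continuous orbit map.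
  obtain ⟨x, hx⟩ := he.exists_dist_lt u (by positivity : 0 < ε / 3)
  have h1 := (Metric.continuousAt_iff'.1 ((hcont x).continuousAt (x := g₀))) (ε / 3) (by positivity)
  filter_upwards [h1] with g hg
  change dist (A g u) (A g₀ u) < ε
  have h2 : dist (A g u) (e (ρ g x)) < ε / 3 := by
    rw [← hA, (A g).isometry.dist_eq]; exact hx
  have h3 : dist (e (ρ g₀ x)) (A g₀ u) < ε / 3 := by
    rw [← hA, (A g₀).isometry.dist_eq, dist_comm]; exact hx
  calc dist (A g u) (A g₀ u) ≤ dist (A g u) (e (ρ g x)) + dist (e (ρ g x)) (e (ρ g₀ x)) +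
        dist (e (ρ g₀ x)) (A g₀ u) := dist_triangle4 _ _ _ _
    _ < ε := by linarith

variable {G : Type u} [Group G] [TopologicalSpace G] [IsTopologicalGroup G]
  {V : Type v} [NormedAddCommGroup V] [InnerProductSpace ℂ V] [CompleteSpace V]
  {J : Subgroup G} {Λ : Representation ℂ J V}

/-- The embedding of `c-Ind_J^G Λ` in the Hilbert space of square-summable families. -/
noncomputable def compactInductionToLp (hJ : IsOpen (J : Set G)) :
    compactInductionSpace J Λ →ₗ[ℂ] lp (fun _ : G ⧸ J => V) 2 where
  toFun f := ⟨fun q => (f : G → V) (q.out)⁻¹, (memℓp_zero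
    (finite_support_compactInduction hJ f)).of_exponent_ge zero_le⟩
  map_add' _ _ := rfl
  map_smul' _ _ := rfl

-- Translation by x permutes the cosets; the change of representatives costs only operators Λ(j),
-- which are isometries.
omit [CompleteSpace V] in
theorem norm_compactInductionToLp (hJ : IsOpen (J : Set G)) (hiso : ∀ j v, ‖Λ j v‖ = ‖v‖) (x : G)
    (f : compactInductionSpace J Λ) :
    ‖compactInductionToLp hJ (compactInduction J Λ x f)‖ = ‖compactInductionToLp hJ f‖ := by
  rw [lp.norm_eq_tsum_rpow (by simp), lp.norm_eq_tsum_rpow (by simp)]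
  congr 1
  conv_rhs => rw [← (MulAction.toPerm x⁻¹ : Equiv.Perm (G ⧸ J)).tsum_eq]
  refine tsum_congr fun q => ?_
  congr 1
  obtain ⟨j, hj⟩ := apply_inv_eq f (x⁻¹ * q.out)
  change ‖(f : G → V) (q.out⁻¹ * x)‖ = ‖(f : G → V) (x⁻¹ • q).out⁻¹‖
  have h1 : x⁻¹ • q = QuotientGroup.mk (x⁻¹ * q.out) := by
    conv_lhs => rw [← QuotientGroup.out_eq' q]
    rfl
  rw [h1, ← hiso j ((f : G → V) _⁻¹), ← hj, _root_.mul_inv_rev, inv_inv]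

/-- Compact induction of a unitarizable representation has a unitary completion. -/
theorem exists_isCompletionOf_compactInduction (hJ : IsOpen (J : Set G))
    (hiso : ∀ j v, ‖Λ j v‖ = ‖v‖) :
    ∃ (H : Type (max u v)) (_ : NormedAddCommGroup H) (_ : InnerProductSpace ℂ H)
      (_ : CompleteSpace H) (π : UnitaryRep G H), π.IsCompletionOf (compactInduction J Λ) := by
  let φ := compactInductionToLp (Λ := Λ) hJ
  -- Passing to the closure of the image makes density automatic.
  let W := (LinearMap.range φ).topologicalClosure
  let e : compactInductionSpace J Λ →ₗ[ℂ] W :=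
    φ.codRestrict W fun f => Submodule.le_topologicalClosure _ ⟨f, rfl⟩
  have he : DenseRange e := by
    intro u
    rw [Topology.IsInducing.subtypeVal.closure_eq_preimage_closure_image]
    have h1 : ((↑) : W → lp (fun _ : G ⧸ J => V) 2) '' Set.range e = LinearMap.range φ := by
      rw [← Set.range_comp]
      rfl
    change (u : lp (fun _ : G ⧸ J => V) 2) ∈ closure (((↑) : W → _) '' Set.range e)
    rw [h1]
    exact u.2
  have hinj : Function.Injective e := by
    intro f f' h
    have h1 : φ f = φ f' := congrArg Subtype.val h
    ext g
    obtain ⟨j, hj⟩ := apply_inv_eq (f - f') g⁻¹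
    have h2 : (f : G → V) ((QuotientGroup.mk g⁻¹ : G ⧸ J).out)⁻¹ =
        (f' : G → V) ((QuotientGroup.mk g⁻¹ : G ⧸ J).out)⁻¹ :=
      congrArg (fun F : lp (fun _ : G ⧸ J => V) 2 => F (QuotientGroup.mk g⁻¹)) h1
    rw [inv_inv] at hj
    have h3 : ∀ y, ((f - f' : compactInductionSpace J Λ) : G → V) y =
        (f : G → V) y - (f' : G → V) y := fun y => rfl
    rw [h3, h3, h2, sub_self, map_zero, sub_eq_zero] at hj
    exact hj
  obtain ⟨π, hπ⟩ := exists_unitaryRep_of_dense (compactInduction J Λ) e he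
    (norm_compactInductionToLp hJ hiso) (fun f => by
      obtain ⟨U, hU⟩ := f.2.2.1
      rw [continuous_iff_continuousAt]
      intro g₀
      -- Orbit maps are locally constant: f is invariant under an open subgroup U, so the orbit map
      -- is constant on g₀U.
      refine continuousAt_const.congr (f := fun _ => e (compactInduction J Λ g₀ f)) ?_
      have h1 : {g | g₀⁻¹ * g ∈ U} ∈ nhds g₀ := by
        refine (continuous_const_mul g₀⁻¹).continuousAt.preimage_mem_nhds ?_
        rw [inv_mul_cancel]
        exact U.isOpen.mem_nhds (one_mem U)
      filter_upwards [h1] with g hg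
      congr 1
      ext y
      rw [compactInduction_apply, compactInduction_apply, ← hU _ hg, mul_assoc,
        mul_inv_cancel_left])
  exact ⟨W, inferInstance, inferInstance, inferInstance, π, e, hinj, he, fun g x => (hπ g x).symm⟩

end Existence

/-! ### Uniqueness of invariant sesquilinear forms, and irreducibility -/

section InvariantForms

variable {G : Type*} [Group G] [TopologicalSpace G] [IsTopologicalGroup G]
  {V : Type*} [NormedAddCommGroup V] [InnerProductSpace ℂ V]
  {J : Subgroup G}

/-- The properties of a unitary representation `Λ` of `J` from which the irreducibility of its
compact induction follows: it is smooth, every operator commuting with it is a scalar, and no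
element outside of `J` intertwines it. -/
structure IsIrreduciblyInducing (Λ : Representation ℂ J V) : Prop where
  isTrivialOnOpen : IsTrivialOnOpen Λ
  inner_map : ∀ j v w, inner ℂ (Λ j v) (Λ j w) = inner ℂ v w
  schur : ∀ T : V →ₗ[ℂ] V, (∀ j, T ∘ₗ Λ j = Λ j ∘ₗ T) → ∃ c : ℂ, T = c • LinearMap.id
  intertwiner : ∀ x ∉ J, ∀ T : V →ₗ[ℂ] V,
    (∀ j j' : J, x * j = j' * x → T ∘ₗ Λ j = Λ j' ∘ₗ T) → T = 0

variable {Λ : Representation ℂ J V}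

/-- Riesz representation: it turns forms on V into operators, to which the Schur and intertwining
hypotheses apply. -/
theorem exists_eq_inner_map [FiniteDimensional ℂ V] (B : V →ₗ⋆[ℂ] V →ₗ[ℂ] ℂ) :
    ∃ T : V →ₗ[ℂ] V, ∀ v w, B v w = inner ℂ v (T w) := by
  let b := stdOrthonormalBasis ℂ V
  refine ⟨∑ i, (B (b i)).smulRight (b i), fun v w => ?_⟩
  conv_lhs => rw [← b.sum_repr v]
  simp only [LinearMap.sum_apply, LinearMap.smulRight_apply, inner_sum, inner_smul_right, map_sum,
    LinearMap.map_smulₛₗ, LinearMap.smul_apply, smul_eq_mul]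
  refine Finset.sum_congr rfl fun i _ => ?_
  rw [b.repr_apply_apply, inner_conj_symm, mul_comm]

omit [IsTopologicalGroup G] in
theorem IsIrreduciblyInducing.inner_map_left (hΛ : IsIrreduciblyInducing Λ) (j : J) (v w : V) :
    inner ℂ (Λ j⁻¹ v) w = inner ℂ v (Λ j w) := by
  rw [← hΛ.inner_map j, ← Module.End.mul_apply, ← map_mul, mul_inv_cancel, map_one,
    Module.End.one_apply]

variable [FiniteDimensional ℂ V]

/-- The sesquilinear form `(v, w) ↦ B(f_v, ρ(x) f_w)`. -/
noncomputable def matrixCoefficientForm (hΛ : IsIrreduciblyInducing Λ)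
    (B : compactInductionSpace J Λ →ₗ⋆[ℂ] compactInductionSpace J Λ →ₗ[ℂ] ℂ) (x : G) :
    V →ₗ⋆[ℂ] V →ₗ[ℂ] ℂ :=
  LinearMap.mk₂'ₛₗ (starRingEnd ℂ) (RingHom.id ℂ)
    (fun v w => B (extendByZero hΛ.isTrivialOnOpen v)
      (compactInduction J Λ x (extendByZero hΛ.isTrivialOnOpen w)))
    (fun _ _ _ => by simp only [map_add, LinearMap.add_apply])
    (fun _ _ _ => by simp only [map_smul, LinearMap.map_smulₛₗ, LinearMap.smul_apply])
    (fun _ _ _ => by simp only [map_add])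
    (fun _ _ _ => by simp only [map_smul, RingHom.id_apply])

variable (hΛ : IsIrreduciblyInducing Λ)
  {B : compactInductionSpace J Λ →ₗ⋆[ℂ] compactInductionSpace J Λ →ₗ[ℂ] ℂ}
  (hB : ∀ g x y, B (compactInduction J Λ g x) (compactInduction J Λ g y) = B x y)

omit [FiniteDimensional ℂ V] in
include hB in
theorem invariantForm_intertwines (x : G) (j j' : J) (h : x * j = j' * x) (v w : V) :
    B (extendByZero hΛ.isTrivialOnOpen v)
      (compactInduction J Λ x (extendByZero hΛ.isTrivialOnOpen (Λ j w))) =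
    B (extendByZero hΛ.isTrivialOnOpen (Λ j'⁻¹ v))
      (compactInduction J Λ x (extendByZero hΛ.isTrivialOnOpen w)) := by
  rw [← compactInduction_extendByZero, ← compactInduction_extendByZero, ← Module.End.mul_apply,
    ← map_mul, h, map_mul, Module.End.mul_apply, ← hB j'⁻¹, Subgroup.coe_inv,
    ← Module.End.mul_apply (compactInduction J Λ _) (compactInduction J Λ _), ← map_mul,
    inv_mul_cancel, map_one, Module.End.one_apply]

-- The operator representing this form satisfies the intertwining relations for x by invariance of
-- `B`, hence is zero off J.
include hB in
theorem invariantForm_eq_zero {x : G} (hx : x ∉ J) (v w : V) :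
    B (extendByZero hΛ.isTrivialOnOpen v)
      (compactInduction J Λ x (extendByZero hΛ.isTrivialOnOpen w)) = 0 := by
  obtain ⟨T, hT⟩ := exists_eq_inner_map (matrixCoefficientForm hΛ B x)
  have hT0 : T = 0 := by
    refine hΛ.intertwiner x hx T fun j j' h => LinearMap.ext fun w => ext_inner_left ℂ fun v => ?_
    rw [LinearMap.comp_apply, LinearMap.comp_apply, ← hT, ← hΛ.inner_map_left, ← hT]
    exact invariantForm_intertwines hΛ hB x j j' h v w
  have := hT v w
  rw [hT0, LinearMap.zero_apply, inner_zero_right] at this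
  exact this

-- The case x = 1: the representing operator commutes with Λ, so Schur's lemma applies.
include hB in
theorem exists_invariantForm_eq_smul : ∃ c : ℂ, ∀ v w : V,
    B (extendByZero hΛ.isTrivialOnOpen v) (extendByZero hΛ.isTrivialOnOpen w) =
      c * inner ℂ v w := by
  obtain ⟨T, hT⟩ := exists_eq_inner_map (matrixCoefficientForm hΛ B 1)
  obtain ⟨c, hc⟩ : ∃ c : ℂ, T = c • LinearMap.id := by
    refine hΛ.schur T fun j => LinearMap.ext fun w => ext_inner_left ℂ fun v => ?_
    rw [LinearMap.comp_apply, LinearMap.comp_apply, ← hT, ← hΛ.inner_map_left, ← hT]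
    exact invariantForm_intertwines hΛ hB 1 j j (by simp) v w
  refine ⟨c, fun v w => ?_⟩
  have := hT v w
  rw [hc, LinearMap.smul_apply, LinearMap.id_apply, inner_smul_right] at this
  rw [← this]
  change _ = B _ (compactInduction J Λ 1 _)
  rw [map_one, Module.End.one_apply]

include hΛ hB in
/-- Invariant sesquilinear forms on the compact induction are unique up to scalars. -/
theorem exists_invariantForm_eq
    {B₀ : compactInductionSpace J Λ →ₗ⋆[ℂ] compactInductionSpace J Λ →ₗ[ℂ] ℂ}
    (hB₀ : ∀ g x y, B₀ (compactInduction J Λ g x) (compactInduction J Λ g y) = B₀ x y)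
    (hpos : ∀ x, B₀ x x = 0 → x = 0) : ∃ c : ℂ, ∀ x y, B x y = c * B₀ x y := by
  obtain ⟨c, hc⟩ := exists_invariantForm_eq_smul hΛ hB
  obtain ⟨c₀, hc₀⟩ := exists_invariantForm_eq_smul hΛ hB₀
  have hgen : ∀ b : ℂ, (∀ v w : V, B (extendByZero hΛ.isTrivialOnOpen v)
      (extendByZero hΛ.isTrivialOnOpen w) = b * B₀ (extendByZero hΛ.isTrivialOnOpen v)
      (extendByZero hΛ.isTrivialOnOpen w)) → ∀ x y, B x y = b * B₀ x y := by
    intro b hb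
    have h1 : ∀ (g h : G) (v w : V),
        B (compactInduction J Λ g (extendByZero hΛ.isTrivialOnOpen v))
          (compactInduction J Λ h (extendByZero hΛ.isTrivialOnOpen w)) =
        b * B₀ (compactInduction J Λ g (extendByZero hΛ.isTrivialOnOpen v))
          (compactInduction J Λ h (extendByZero hΛ.isTrivialOnOpen w)) := by
      intro g h v w
      have e : compactInduction J Λ h (extendByZero hΛ.isTrivialOnOpen w) =
          compactInduction J Λ g (compactInduction J Λ (g⁻¹ * h)
            (extendByZero hΛ.isTrivialOnOpen w)) := by
        rw [← Module.End.mul_apply, ← map_mul, mul_inv_cancel_left]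
      rw [e, hB, hB₀]
      by_cases hgh : g⁻¹ * h ∈ J
      · have := compactInduction_extendByZero hΛ.isTrivialOnOpen ⟨_, hgh⟩ w
        simp only at this
        rw [this, hb]
      · rw [invariantForm_eq_zero hΛ hB hgh, invariantForm_eq_zero hΛ hB₀ hgh, mul_zero]
    have hBB : B = b • B₀ := by
      refine LinearMap.ext_on (span_extendByZero hΛ.isTrivialOnOpen) ?_
      rintro _ ⟨⟨g, v⟩, rfl⟩
      refine LinearMap.ext_on (span_extendByZero hΛ.isTrivialOnOpen) ?_
      rintro _ ⟨⟨h, w⟩, rfl⟩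
      exact h1 g h v w
    intro x y
    rw [hBB]
    rfl
  -- If c₀ = 0, definiteness of `B₀` forces V = 0 and any constant works; otherwise the constant is
  -- c / c₀.
  by_cases hc0 : c₀ = 0
  · refine ⟨0, hgen 0 fun v w => ?_⟩
    have : v = 0 := by
      apply extendByZero_injective hΛ.isTrivialOnOpen
      rw [map_zero]
      apply hpos
      rw [hc₀, hc0, zero_mul]
    rw [this, map_zero, map_zero, LinearMap.zero_apply, zero_mul]
  · refine ⟨c / c₀, hgen _ fun v w => ?_⟩
    rw [hc, hc₀, ← mul_assoc, div_mul_cancel₀ _ hc0]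

end InvariantForms

/-! ### Irreducibility of completions -/

section Irreducible

variable {G : Type*} [Group G] [TopologicalSpace G] [IsTopologicalGroup G]
  {V : Type*} [NormedAddCommGroup V] [InnerProductSpace ℂ V] [FiniteDimensional ℂ V]
  {J : Subgroup G} {Λ : Representation ℂ J V}
  {H : Type*} [NormedAddCommGroup H] [InnerProductSpace ℂ H]

omit [IsTopologicalGroup G] in
theorem UnitaryRep.inner_map (π : UnitaryRep G H) (g : G) (u v : H) :
    inner ℂ (π.toHom g u) (π.toHom g v) = inner ℂ u v :=
  (π.toHom g).inner_map_map u v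

/-- Invariant sesquilinear forms on the compact induction are multiples of the inner product of
a completion. -/
theorem exists_invariantForm_eq_inner (hΛ : IsIrreduciblyInducing Λ) (π : UnitaryRep G H)
    (ι : compactInductionSpace J Λ →ₗ[ℂ] H) (hι : Function.Injective ι)
    (hπ : ∀ g x, ι (compactInduction J Λ g x) = π.toHom g (ι x))
    (B : compactInductionSpace J Λ →ₗ⋆[ℂ] compactInductionSpace J Λ →ₗ[ℂ] ℂ)
    (hB : ∀ g x y, B (compactInduction J Λ g x) (compactInduction J Λ g y) = B x y) :
    ∃ c : ℂ, ∀ x y, B x y = c * inner ℂ (ι x) (ι y) := by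
  let B₀ : compactInductionSpace J Λ →ₗ⋆[ℂ] compactInductionSpace J Λ →ₗ[ℂ] ℂ :=
    LinearMap.mk₂'ₛₗ (starRingEnd ℂ) (RingHom.id ℂ) (fun x y => inner ℂ (ι x) (ι y))
      (fun _ _ _ => by rw [map_add, inner_add_left])
      (fun _ _ _ => by rw [map_smul, inner_smul_left]; rfl)
      (fun _ _ _ => by rw [map_add, inner_add_right])
      (fun _ _ _ => by rw [map_smul, inner_smul_right]; rfl)
  refine exists_invariantForm_eq hΛ hB (B₀ := B₀) (fun g x y => ?_) (fun x hx => ?_)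
  · change inner ℂ (ι _) (ι _) = inner ℂ _ _
    rw [hπ, hπ, π.inner_map]
  · exact hι ((inner_self_eq_zero.1 hx).trans (map_zero ι).symm)

/-- Completions of the compact induction are irreducible. -/
theorem isIrreducible_of_isCompletionOf [CompleteSpace H] [Nontrivial V]
    (hΛ : IsIrreduciblyInducing Λ) (π : UnitaryRep G H)
    (hπ : π.IsCompletionOf (compactInduction J Λ)) : π.IsIrreducible := by
  obtain ⟨ι, hι, hd, hπ⟩ := hπ
  refine ⟨?_, fun W hW hinv => ?_⟩
  · obtain ⟨v, hv⟩ := exists_ne (0 : V)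
    refine ⟨ι (extendByZero hΛ.isTrivialOnOpen v), 0, fun h => hv ?_⟩
    exact extendByZero_injective hΛ.isTrivialOnOpen
      ((hι (h.trans (map_zero ι).symm)).trans (map_zero _).symm)
  · have : CompleteSpace W := hW.completeSpace_coe
    let P := W.starProjection
    have hP : ∀ g u, P (π.toHom g u) = π.toHom g (P u) := by
      intro g u
      refine Submodule.eq_starProjection_of_mem_of_inner_eq_zero
        (hinv g _ (Submodule.starProjection_apply_mem W u)) fun w hw => ?_
      have h1 : w = π.toHom g (π.toHom g⁻¹ w) := by
        have : π.toHom g * π.toHom g⁻¹ = 1 := by rw [← map_mul, mul_inv_cancel, map_one]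
        exact (congrArg (fun T : H ≃ₗᵢ[ℂ] H => T w) this).symm
      rw [← map_sub, h1, π.inner_map]
      exact Submodule.starProjection_inner_eq_zero u _ (hinv _ _ hw)
    -- The projection onto an invariant closed subspace commutes with G, so this form is invariant.
    -- It is then a multiple of the inner product, and by density the projection is a scalar.
    let B : compactInductionSpace J Λ →ₗ⋆[ℂ] compactInductionSpace J Λ →ₗ[ℂ] ℂ :=
      LinearMap.mk₂'ₛₗ (starRingEnd ℂ) (RingHom.id ℂ) (fun x y => inner ℂ (ι x) (P (ι y)))
        (fun _ _ _ => by rw [map_add, inner_add_left])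
        (fun _ _ _ => by rw [map_smul, inner_smul_left]; rfl)
        (fun _ _ _ => by rw [map_add, map_add, inner_add_right])
        (fun _ _ _ => by rw [map_smul, map_smul, inner_smul_right]; rfl)
    obtain ⟨c, hc⟩ := exists_invariantForm_eq_inner hΛ π ι hι hπ B (fun g x y => by
      change inner ℂ (ι _) (P (ι _)) = inner ℂ _ (P _)
      rw [hπ, hπ, hP, π.inner_map])
    have hPc : ∀ u, P u = c • u := by
      intro u
      refine hd.induction_on (p := fun u => P u = c • u) u
        (isClosed_eq P.continuous (continuous_const_smul c)) fun y => ?_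
      refine ext_inner_left ℂ fun v => ?_
      refine hd.induction_on (p := fun v => inner ℂ v (P (ι y)) = inner ℂ v (c • ι y)) v
        (isClosed_eq (by fun_prop) (by fun_prop)) fun x => ?_
      rw [inner_smul_right]
      exact hc x y
    by_cases hbot : W = ⊥
    · exact Or.inl hbot
    · right
      obtain ⟨w, hw, hw0⟩ := (Submodule.ne_bot_iff W).1 hbot
      have h1 : c • w = (1 : ℂ) • w := by
        rw [← hPc, one_smul]
        exact Submodule.starProjection_eq_self_iff.2 hw
      have hc1 : c = 1 := smul_left_injective ℂ hw0 h1
      rw [Submodule.eq_top_iff']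
      intro u
      rw [← Submodule.starProjection_eq_self_iff]
      change P u = u
      rw [hPc, hc1, one_smul]

end Irreducible

/-! ### Products of matrix coefficients on `G/Z` -/

namespace UnitaryRep

section Coefficients

variable {G : Type*} [Group G] [TopologicalSpace G] [IsTopologicalGroup G]
  {H : Type*} [NormedAddCommGroup H] [InnerProductSpace ℂ H] (π : UnitaryRep G H)

/-- The center acts by scalars of absolute value one. -/
def HasCentralCharacter : Prop :=
  ∀ z ∈ Subgroup.center G, ∃ c : Circle, ∀ u, π.toHom z u = (c : ℂ) • u

/-- The function `(π(g)u, v) conj (π(g)u', v')` on `G/Z`. -/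
noncomputable def coeffProduct (u v u' v' : H) (q : G ⧸ Subgroup.center G) : ℂ :=
  inner ℂ v (π.toHom q.out u) * conj (inner ℂ v' (π.toHom q.out u'))

variable {π}

omit [IsTopologicalGroup G] in
theorem map_mul_apply (g h : G) (u : H) :
    π.toHom (g * h) u = π.toHom g (π.toHom h u) := by
  rw [map_mul]; rfl

omit [IsTopologicalGroup G] in
theorem inner_map_right (g : G) (u v : H) :
    inner ℂ v (π.toHom g u) = inner ℂ (π.toHom g⁻¹ v) u := by
  rw [← π.inner_map g⁻¹ v, ← map_mul_apply, inv_mul_cancel, map_one]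
  rfl

-- The central scalar enters once as itself and once conjugated; having absolute value one, it
-- cancels, and the choice of representative does not matter.
omit [IsTopologicalGroup G] in
theorem coeffProduct_mk (hZ : π.HasCentralCharacter) (u v u' v' : H) (g : G) :
    π.coeffProduct u v u' v' (QuotientGroup.mk g) =
      inner ℂ v (π.toHom g u) * conj (inner ℂ v' (π.toHom g u')) := by
  obtain ⟨z, hz⟩ := QuotientGroup.mk_out_eq_mul (Subgroup.center G) g
  obtain ⟨c, hc⟩ := hZ z z.2
  rw [coeffProduct, hz, map_mul_apply, map_mul_apply, hc, hc, map_smul, map_smul,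
    inner_smul_right, inner_smul_right, map_mul, mul_mul_mul_comm, Complex.mul_conj,
    Circle.normSq_coe, Complex.ofReal_one, one_mul]

omit [IsTopologicalGroup G] in
theorem continuous_coeffProduct (hZ : π.HasCentralCharacter) (u v u' v' : H) :
    Continuous (π.coeffProduct u v u' v') := by
  rw [(QuotientGroup.isQuotientMap_mk (N := Subgroup.center G)).continuous_iff]
  have : π.coeffProduct u v u' v' ∘ QuotientGroup.mk =
      fun g => inner ℂ v (π.toHom g u) * conj (inner ℂ v' (π.toHom g u')) :=
    funext fun g => coeffProduct_mk hZ u v u' v' g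
  rw [this]
  exact (continuous_const.inner (π.continuous_apply u)).mul
    (Complex.continuous_conj.comp (continuous_const.inner (π.continuous_apply u')))

omit [IsTopologicalGroup G] in
theorem coeffProduct_mul_right (hZ : π.HasCentralCharacter) (u v u' v' : H) (x : G)
    (q : G ⧸ Subgroup.center G) :
    π.coeffProduct (π.toHom x u) v (π.toHom x u') v' q =
      π.coeffProduct u v u' v' (q * (QuotientGroup.mk x : G ⧸ Subgroup.center G)) := by
  obtain ⟨g, rfl⟩ := QuotientGroup.mk_surjective q
  rw [← QuotientGroup.mk_mul, coeffProduct_mk hZ, coeffProduct_mk hZ, map_mul_apply, map_mul_apply]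

omit [IsTopologicalGroup G] in
theorem coeffProduct_mul_left (hZ : π.HasCentralCharacter) (u v u' v' : H) (x : G)
    (q : G ⧸ Subgroup.center G) :
    π.coeffProduct u (π.toHom x v) u' (π.toHom x v') q =
      π.coeffProduct u v u' v' ((QuotientGroup.mk x⁻¹ : G ⧸ Subgroup.center G) * q) := by
  obtain ⟨g, rfl⟩ := QuotientGroup.mk_surjective q
  rw [← QuotientGroup.mk_mul, coeffProduct_mk hZ, coeffProduct_mk hZ, map_mul_apply, map_mul_apply,
    inner_map_right x⁻¹, inner_map_right x⁻¹, inv_inv]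

omit [IsTopologicalGroup G] in
theorem coeffProduct_conj (u v u' v' : H) (q : G ⧸ Subgroup.center G) :
    π.coeffProduct u v u' v' q = conj (π.coeffProduct u' v' u v q) := by
  simp only [coeffProduct, map_mul, Complex.conj_conj, mul_comm]

omit [IsTopologicalGroup G] in
theorem coeffProduct_self (u v : H) (q : G ⧸ Subgroup.center G) :
    π.coeffProduct u v u v q = ((‖inner ℂ v (π.toHom q.out u)‖ ^ 2 : ℝ) : ℂ) := by
  rw [coeffProduct, Complex.mul_conj, Complex.normSq_eq_norm_sq]

-- The inequality 2xy ≤ x² + y² reduces integrability of mixed products to that of squared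
-- coefficients.
omit [IsTopologicalGroup G] in
theorem norm_coeffProduct_le (u v u' v' : H) (q : G ⧸ Subgroup.center G) :
    ‖π.coeffProduct u v u' v' q‖ ≤
      (‖π.coeffProduct u v u v q‖ + ‖π.coeffProduct u' v' u' v' q‖) / 2 := by
  simp only [coeffProduct, norm_mul, RCLike.norm_conj]
  nlinarith [sq_nonneg (‖inner ℂ v (π.toHom q.out u)‖ - ‖inner ℂ v' (π.toHom q.out u')‖)]

omit [IsTopologicalGroup G] in
theorem coeffProduct_add_first (u₁ u₂ v u' v' : H) :
    π.coeffProduct (u₁ + u₂) v u' v' =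
      π.coeffProduct u₁ v u' v' + π.coeffProduct u₂ v u' v' := by
  ext q
  simp only [coeffProduct, map_add, inner_add_right, add_mul, Pi.add_apply]

omit [IsTopologicalGroup G] in
theorem coeffProduct_smul_first (c : ℂ) (u v u' v' : H) :
    π.coeffProduct (c • u) v u' v' = c • π.coeffProduct u v u' v' := by
  ext q
  simp only [coeffProduct, map_smul, inner_smul_right, Pi.smul_apply, smul_eq_mul, mul_assoc]

omit [IsTopologicalGroup G] in
theorem coeffProduct_add_fourth (u v u' v₁ v₂ : H) :
    π.coeffProduct u v u' (v₁ + v₂) =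
      π.coeffProduct u v u' v₁ + π.coeffProduct u v u' v₂ := by
  ext q
  simp only [coeffProduct, map_add, inner_add_left, mul_add, Pi.add_apply]

omit [IsTopologicalGroup G] in
theorem coeffProduct_smul_fourth (c : ℂ) (u v u' v' : H) :
    π.coeffProduct u v u' (c • v') = c • π.coeffProduct u v u' v' := by
  ext q
  simp only [coeffProduct, inner_smul_left, Pi.smul_apply, smul_eq_mul, map_mul, Complex.conj_conj]
  ring

omit [IsTopologicalGroup G] in
theorem coeffProduct_add_third (u v u₁ u₂ v' : H) :
    π.coeffProduct u v (u₁ + u₂) v' =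
      π.coeffProduct u v u₁ v' + π.coeffProduct u v u₂ v' := by
  ext q
  simp only [coeffProduct, map_add, inner_add_right, mul_add, Pi.add_apply]

omit [IsTopologicalGroup G] in
theorem coeffProduct_smul_third (c : ℂ) (u v u' v' : H) :
    π.coeffProduct u v (c • u') v' = conj c • π.coeffProduct u v u' v' := by
  ext q
  simp only [coeffProduct, map_smul, inner_smul_right, Pi.smul_apply, smul_eq_mul, map_mul]
  ring

omit [IsTopologicalGroup G] in
theorem coeffProduct_add_second (u v₁ v₂ u' v' : H) :
    π.coeffProduct u (v₁ + v₂) u' v' =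
      π.coeffProduct u v₁ u' v' + π.coeffProduct u v₂ u' v' := by
  ext q
  simp only [coeffProduct, inner_add_left, add_mul, Pi.add_apply]

omit [IsTopologicalGroup G] in
theorem coeffProduct_smul_second (c : ℂ) (u v u' v' : H) :
    π.coeffProduct u (c • v) u' v' = conj c • π.coeffProduct u v u' v' := by
  ext q
  simp only [coeffProduct, inner_smul_left, Pi.smul_apply, smul_eq_mul, mul_assoc]

end Coefficients

/-! ### Extension of Schur's relations from a dense subspace -/

section Extension

variable {G : Type*} [Group G] [TopologicalSpace G] [IsTopologicalGroup G]
  {H : Type*} [NormedAddCommGroup H] [InnerProductSpace ℂ H] {π : UnitaryRep G H}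
  [MeasurableSpace (G ⧸ Subgroup.center G)] [BorelSpace (G ⧸ Subgroup.center G)]
  {μ : Measure (G ⧸ Subgroup.center G)} {E : Type*} {ι : E → H} {c : ℝ}

-- Fatou's lemma along sequences from the dense subspace. It gives square-integrability for all
-- vectors before any integral is known to depend continuously on them.
omit [IsTopologicalGroup G] in
theorem lintegral_coeffProduct_self_le (hZ : π.HasCentralCharacter) (hι : DenseRange ι)
    (hint : ∀ a b, Integrable (π.coeffProduct (ι a) (ι b) (ι a) (ι b)) μ)
    (hc : ∀ a b, ∫ q, π.coeffProduct (ι a) (ι b) (ι a) (ι b) q ∂μ =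
      c * (inner ℂ (ι a) (ι a) * inner ℂ (ι b) (ι b))) (u v : H) :
    ∫⁻ q, ‖π.coeffProduct u v u v q‖ₑ ∂μ ≤ ENNReal.ofReal (c * (‖u‖ ^ 2 * ‖v‖ ^ 2)) := by
  have hseq : ∀ u : H, ∃ a : ℕ → E, Filter.Tendsto (fun n => ι (a n)) Filter.atTop (nhds u) := by
    intro u
    obtain ⟨x, hx, hxu⟩ := mem_closure_iff_seq_limit.1 (hι u)
    choose a ha using hx
    exact ⟨a, by simpa only [ha] using hxu⟩
  obtain ⟨a, ha⟩ := hseq u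
  obtain ⟨b, hb⟩ := hseq v
  have h1 : ∀ n, ∫⁻ q, ‖π.coeffProduct (ι (a n)) (ι (b n)) (ι (a n)) (ι (b n)) q‖ₑ ∂μ =
      ENNReal.ofReal (c * (‖ι (a n)‖ ^ 2 * ‖ι (b n)‖ ^ 2)) := by
    intro n
    rw [← ofReal_integral_norm_eq_lintegral_enorm (hint _ _)]
    congr 1
    have h2 := hc (a n) (b n)
    have h3 : ∀ q, π.coeffProduct (ι (a n)) (ι (b n)) (ι (a n)) (ι (b n)) q =
        ((‖π.coeffProduct (ι (a n)) (ι (b n)) (ι (a n)) (ι (b n)) q‖ : ℝ) : ℂ) := by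
      intro q
      rw [coeffProduct_self, Complex.norm_real, Real.norm_of_nonneg (by positivity)]
    rw [integral_congr_ae (Filter.Eventually.of_forall h3), integral_complex_ofReal,
      inner_self_eq_norm_sq_to_K, inner_self_eq_norm_sq_to_K] at h2
    refine Complex.ofReal_injective (h2.trans ?_)
    push_cast
    rfl
  have hlim : ∀ q, Filter.Tendsto
      (fun n => ‖π.coeffProduct (ι (a n)) (ι (b n)) (ι (a n)) (ι (b n)) q‖ₑ) Filter.atTop
      (nhds ‖π.coeffProduct u v u v q‖ₑ) := by
    intro q
    have h2 : Filter.Tendsto (fun n => inner ℂ (ι (b n)) (π.toHom q.out (ι (a n)))) Filter.atTop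
        (nhds (inner ℂ v (π.toHom q.out u))) :=
      hb.inner (((π.toHom q.out).continuous.tendsto u).comp ha)
    exact (h2.mul ((Complex.continuous_conj.tendsto _).comp h2)).enorm
  calc ∫⁻ q, ‖π.coeffProduct u v u v q‖ₑ ∂μ
      = ∫⁻ q, Filter.liminf (fun n =>
          ‖π.coeffProduct (ι (a n)) (ι (b n)) (ι (a n)) (ι (b n)) q‖ₑ) Filter.atTop ∂μ :=
        lintegral_congr fun q => (hlim q).liminf_eq.symm
    _ ≤ Filter.liminf (fun n => ∫⁻ q,
          ‖π.coeffProduct (ι (a n)) (ι (b n)) (ι (a n)) (ι (b n)) q‖ₑ ∂μ) Filter.atTop :=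
        lintegral_liminf_le fun n => (continuous_coeffProduct hZ _ _ _ _).enorm.measurable
    _ = ENNReal.ofReal (c * (‖u‖ ^ 2 * ‖v‖ ^ 2)) := by
        simp_rw [h1]
        refine Filter.Tendsto.liminf_eq (ENNReal.tendsto_ofReal ?_)
        exact ((ha.norm.pow 2).mul (hb.norm.pow 2)).const_mul c

variable (hZ : π.HasCentralCharacter)
  (hle : ∀ u v, ∫⁻ q, ‖π.coeffProduct u v u v q‖ₑ ∂μ ≤ ENNReal.ofReal (c * (‖u‖ ^ 2 * ‖v‖ ^ 2)))

include hZ hle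

omit [IsTopologicalGroup G] in
theorem integrable_coeffProduct_self (u v : H) : Integrable (π.coeffProduct u v u v) μ :=
  ⟨(continuous_coeffProduct hZ u v u v).aestronglyMeasurable,
    (hle u v).trans_lt ENNReal.ofReal_lt_top⟩

omit [IsTopologicalGroup G] in
theorem integrable_coeffProduct (u v u' v' : H) : Integrable (π.coeffProduct u v u' v') μ :=
  (((integrable_coeffProduct_self hZ hle u v).norm.add
    (integrable_coeffProduct_self hZ hle u' v').norm).div_const 2).mono'
    (continuous_coeffProduct hZ u v u' v').aestronglyMeasurable
    (Filter.Eventually.of_forall fun q => norm_coeffProduct_le u v u' v' q)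

omit [IsTopologicalGroup G] in
theorem norm_integral_coeffProduct_le (hc0 : 0 ≤ c) (u v u' v' : H) :
    ‖∫ q, π.coeffProduct u v u' v' q ∂μ‖ ≤
      (c * (‖u‖ ^ 2 * ‖v‖ ^ 2) + c * (‖u'‖ ^ 2 * ‖v'‖ ^ 2)) / 2 := by
  have h1 : ∀ u v, ∫ q, ‖π.coeffProduct u v u v q‖ ∂μ ≤ c * (‖u‖ ^ 2 * ‖v‖ ^ 2) := by
    intro u v
    rw [integral_norm_eq_lintegral_enorm (integrable_coeffProduct_self hZ hle u v).1]
    exact ENNReal.toReal_le_of_le_ofReal (by positivity) (hle u v)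
  have hi := fun u v => (integrable_coeffProduct_self hZ hle u v).norm
  calc ‖∫ q, π.coeffProduct u v u' v' q ∂μ‖
      ≤ ∫ q, (‖π.coeffProduct u v u v q‖ + ‖π.coeffProduct u' v' u' v' q‖) / 2 ∂μ :=
        norm_integral_le_of_norm_le (((hi u v).add (hi u' v')).div_const 2)
          (Filter.Eventually.of_forall fun q => norm_coeffProduct_le u v u' v' q)
    _ ≤ _ := by
        rw [integral_div, integral_add (hi u v) (hi u' v')]
        linarith [h1 u v, h1 u' v']

omit [IsTopologicalGroup G] in
theorem continuous_integral_first (hc0 : 0 ≤ c) (v u' v' : H) :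
    Continuous fun u => ∫ q, π.coeffProduct u v u' v' q ∂μ := by
  have hi := integrable_coeffProduct hZ hle
  let f : H →ₗ[ℂ] ℂ :=
    { toFun := fun u => ∫ q, π.coeffProduct u v u' v' q ∂μ
      map_add' := fun u₁ u₂ => by
        rw [coeffProduct_add_first]
        exact integral_add (hi _ _ _ _) (hi _ _ _ _)
      map_smul' := fun a u => by
        rw [coeffProduct_smul_first]
        exact integral_smul a _ }
  -- The available bound is not homogeneous in u, but a linear map bounded on the unit ball is
  -- continuous.
  refine AddMonoidHomClass.continuous_of_bound f _
    (LinearMap.bound_of_ball_bound' one_pos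
      ((c * (1 ^ 2 * ‖v‖ ^ 2) + c * (‖u'‖ ^ 2 * ‖v'‖ ^ 2)) / 2) f fun u hu => ?_)
  refine (norm_integral_coeffProduct_le hZ hle hc0 u v u' v').trans ?_
  have : ‖u‖ ≤ 1 := by simpa using hu
  gcongr

omit [IsTopologicalGroup G] in
theorem continuous_integral_fourth (hc0 : 0 ≤ c) (u v u' : H) :
    Continuous fun v' => ∫ q, π.coeffProduct u v u' v' q ∂μ := by
  have hi := integrable_coeffProduct hZ hle
  let f : H →ₗ[ℂ] ℂ :=
    { toFun := fun v' => ∫ q, π.coeffProduct u v u' v' q ∂μ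
      map_add' := fun v₁ v₂ => by
        rw [coeffProduct_add_fourth]
        exact integral_add (hi _ _ _ _) (hi _ _ _ _)
      map_smul' := fun a v' => by
        rw [coeffProduct_smul_fourth]
        exact integral_smul a _ }
  refine AddMonoidHomClass.continuous_of_bound f _
    (LinearMap.bound_of_ball_bound' one_pos
      ((c * (‖u‖ ^ 2 * ‖v‖ ^ 2) + c * (‖u'‖ ^ 2 * 1 ^ 2)) / 2) f fun v' hv' => ?_)
  refine (norm_integral_coeffProduct_le hZ hle hc0 u v u' v').trans ?_
  have : ‖v'‖ ≤ 1 := by simpa using hv'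
  gcongr

omit [IsTopologicalGroup G] in
/-- Schur's relations extend from a dense subspace. -/
theorem integral_coeffProduct_of_dense (hc0 : 0 ≤ c) (hι : DenseRange ι)
    (hS : ∀ a b a' b', ∫ q, π.coeffProduct (ι a) (ι b) (ι a') (ι b') q ∂μ =
      c * (inner ℂ (ι a') (ι a) * inner ℂ (ι b) (ι b'))) (u v u' v' : H) :
    ∫ q, π.coeffProduct u v u' v' q ∂μ = c * (inner ℂ u' u * inner ℂ v v') := by
  have first : ∀ v u' v', (∀ a, ∫ q, π.coeffProduct (ι a) v u' v' q ∂μ =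
      c * (inner ℂ u' (ι a) * inner ℂ v v')) → ∀ u, ∫ q, π.coeffProduct u v u' v' q ∂μ =
      c * (inner ℂ u' u * inner ℂ v v') := fun v u' v' h u =>
    hι.induction_on (p := fun u => ∫ q, π.coeffProduct u v u' v' q ∂μ =
      c * (inner ℂ u' u * inner ℂ v v')) u
      (isClosed_eq (continuous_integral_first hZ hle hc0 v u' v') (by fun_prop)) h
  have fourth : ∀ u v u', (∀ b, ∫ q, π.coeffProduct u v u' (ι b) q ∂μ =
      c * (inner ℂ u' u * inner ℂ v (ι b))) → ∀ v', ∫ q, π.coeffProduct u v u' v' q ∂μ =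
      c * (inner ℂ u' u * inner ℂ v v') := fun u v u' h v' =>
    hι.induction_on (p := fun v' => ∫ q, π.coeffProduct u v u' v' q ∂μ =
      c * (inner ℂ u' u * inner ℂ v v')) v'
      (isClosed_eq (continuous_integral_fourth hZ hle hc0 u v u') (by fun_prop)) h
  -- Complex conjugation exchanges (u, v) with (u', v'), so continuity in the two linear variables,
  -- first and fourth, is enough to reach all four.
  have swap : ∀ u v u' v', ∫ q, π.coeffProduct u v u' v' q ∂μ =
      c * (inner ℂ u' u * inner ℂ v v') → ∫ q, π.coeffProduct u' v' u v q ∂μ =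
      c * (inner ℂ u u' * inner ℂ v' v) := by
    intro u v u' v' h
    rw [integral_congr_ae (Filter.Eventually.of_forall fun q => coeffProduct_conj u' v' u v q),
      integral_conj, h, map_mul, map_mul, inner_conj_symm, inner_conj_symm, Complex.conj_ofReal]
  exact fourth _ _ _ (fun b => first _ _ _ (fun a => swap _ _ _ _
    (fourth _ _ _ (fun b' => first _ _ _ (fun a' => hS a' b a b') _) _)) _) _

end Extension

end UnitaryRep

/-! ### Schur's relations on the compact induction -/

section Schur

open UnitaryRep

variable {G : Type*} [Group G] [TopologicalSpace G] [IsTopologicalGroup G]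
  {V : Type*} [NormedAddCommGroup V] [InnerProductSpace ℂ V] [FiniteDimensional ℂ V]
  {J : Subgroup G} {Λ : Representation ℂ J V}
  {H : Type*} [NormedAddCommGroup H] [InnerProductSpace ℂ H] {π : UnitaryRep G H}

/-- Matrix coefficients that are supported in a compact set modulo the center. -/
def HasCompactCoeff (π : UnitaryRep G H) (u v : H) : Prop :=
  ∃ C : Set (G ⧸ Subgroup.center G), IsCompact C ∧
    ∀ g : G, inner ℂ v (π.toHom g u) ≠ 0 → (QuotientGroup.mk g : G ⧸ Subgroup.center G) ∈ C

omit [IsTopologicalGroup G] in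
theorem HasCompactCoeff.add_left {u₁ u₂ v : H} (h₁ : HasCompactCoeff π u₁ v)
    (h₂ : HasCompactCoeff π u₂ v) : HasCompactCoeff π (u₁ + u₂) v := by
  obtain ⟨C₁, hC₁, h₁⟩ := h₁
  obtain ⟨C₂, hC₂, h₂⟩ := h₂
  refine ⟨C₁ ∪ C₂, hC₁.union hC₂, fun g hg => ?_⟩
  by_contra hn
  rw [Set.mem_union, not_or] at hn
  rw [map_add, inner_add_right, not_not.1 (mt (h₁ g) hn.1), not_not.1 (mt (h₂ g) hn.2),
    add_zero] at hg
  exact hg rfl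

omit [IsTopologicalGroup G] in
theorem HasCompactCoeff.add_right {u v₁ v₂ : H} (h₁ : HasCompactCoeff π u v₁)
    (h₂ : HasCompactCoeff π u v₂) : HasCompactCoeff π u (v₁ + v₂) := by
  obtain ⟨C₁, hC₁, h₁⟩ := h₁
  obtain ⟨C₂, hC₂, h₂⟩ := h₂
  refine ⟨C₁ ∪ C₂, hC₁.union hC₂, fun g hg => ?_⟩
  by_contra hn
  rw [Set.mem_union, not_or] at hn
  rw [inner_add_left, not_not.1 (mt (h₁ g) hn.1), not_not.1 (mt (h₂ g) hn.2), add_zero] at hg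
  exact hg rfl

omit [IsTopologicalGroup G] in
theorem HasCompactCoeff.smul_left {u v : H} (c : ℂ) (h : HasCompactCoeff π u v) :
    HasCompactCoeff π (c • u) v := by
  obtain ⟨C, hC, h⟩ := h
  refine ⟨C, hC, fun g hg => h g fun h0 => hg ?_⟩
  rw [map_smul, inner_smul_right, h0, mul_zero]

omit [IsTopologicalGroup G] in
theorem HasCompactCoeff.smul_right {u v : H} (c : ℂ) (h : HasCompactCoeff π u v) :
    HasCompactCoeff π u (c • v) := by
  obtain ⟨C, hC, h⟩ := h
  refine ⟨C, hC, fun g hg => h g fun h0 => hg ?_⟩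
  rw [inner_smul_left, h0, mul_zero]

variable {ι : compactInductionSpace J Λ →ₗ[ℂ] H}

section

variable (hΛ : IsIrreduciblyInducing Λ)
  (hπ : ∀ g x, ι (compactInduction J Λ g x) = π.toHom g (ι x))

-- Off J this is the vanishing of invariant forms, applied to the inner product pulled back along ι.
include hπ in
theorem inner_eq_zero_of_notMem {x : G} (hx : x ∉ J) (v w : V) :
    inner ℂ (ι (extendByZero hΛ.isTrivialOnOpen v))
      (π.toHom x (ι (extendByZero hΛ.isTrivialOnOpen w))) = 0 := by
  let B₀ : compactInductionSpace J Λ →ₗ⋆[ℂ] compactInductionSpace J Λ →ₗ[ℂ] ℂ :=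
    LinearMap.mk₂'ₛₗ (starRingEnd ℂ) (RingHom.id ℂ) (fun x y => inner ℂ (ι x) (ι y))
      (fun _ _ _ => by rw [map_add, inner_add_left])
      (fun _ _ _ => by rw [map_smul, inner_smul_left]; rfl)
      (fun _ _ _ => by rw [map_add, inner_add_right])
      (fun _ _ _ => by rw [map_smul, inner_smul_right]; rfl)
  have := invariantForm_eq_zero hΛ (B := B₀) (fun g x y => by
    change inner ℂ (ι _) (ι _) = inner ℂ _ _
    rw [hπ, hπ, π.inner_map]) hx v w
  rw [← hπ]
  exact this

-- Coefficients of vectors supported on J vanish off J. Translating the vectors by x and y moves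
-- this support to yJx⁻¹, still compact modulo Z, and sums and multiples preserve the property.
include hΛ hπ in
theorem hasCompactCoeff_compactInduction
    (hJc : IsCompact ((QuotientGroup.mk : G → G ⧸ Subgroup.center G) '' J))
    (a b : compactInductionSpace J Λ) : HasCompactCoeff π (ι a) (ι b) := by
  have hgen : ∀ (x y : G) (v w : V), HasCompactCoeff π
      (ι (compactInduction J Λ x (extendByZero hΛ.isTrivialOnOpen v)))
      (ι (compactInduction J Λ y (extendByZero hΛ.isTrivialOnOpen w))) := by
    intro x y v w
    refine ⟨(fun q => (QuotientGroup.mk y : G ⧸ Subgroup.center G) * q *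
      (QuotientGroup.mk x⁻¹ : G ⧸ Subgroup.center G)) '' (QuotientGroup.mk '' J),
      hJc.image (by fun_prop), fun g hg => ?_⟩
    rw [hπ, hπ, ← map_mul_apply, ← inv_inv y, ← inner_map_right, ← map_mul_apply] at hg
    have hm : y⁻¹ * (g * x) ∈ J := by
      by_contra h
      exact hg (inner_eq_zero_of_notMem hΛ hπ h w v)
    refine ⟨_, ⟨_, hm, rfl⟩, ?_⟩
    simp only [← QuotientGroup.mk_mul]
    congr 1
    group
  have ha : a ∈ Submodule.span ℂ (Set.range fun p : G × V =>
      compactInduction J Λ p.1 (extendByZero hΛ.isTrivialOnOpen p.2)) := by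
    rw [span_extendByZero]; trivial
  have hb : b ∈ Submodule.span ℂ (Set.range fun p : G × V =>
      compactInduction J Λ p.1 (extendByZero hΛ.isTrivialOnOpen p.2)) := by
    rw [span_extendByZero]; trivial
  have hzl : ∀ v, HasCompactCoeff π 0 v := fun v => ⟨∅, isCompact_empty, fun g hg => by simp at hg⟩
  have hzr : ∀ v, HasCompactCoeff π v 0 := fun v => ⟨∅, isCompact_empty, fun g hg => by simp at hg⟩
  induction ha using Submodule.span_induction with
  | mem a ha =>
    obtain ⟨⟨x, v⟩, rfl⟩ := ha
    induction hb using Submodule.span_induction with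
    | mem b hb =>
      obtain ⟨⟨y, w⟩, rfl⟩ := hb
      exact hgen x y v w
    | zero => rw [map_zero]; exact hzr _
    | add b₁ b₂ _ _ h₁ h₂ => rw [map_add]; exact h₁.add_right h₂
    | smul c b _ h => rw [map_smul]; exact h.smul_right c
  | zero => rw [map_zero]; exact hzl _
  | add a₁ a₂ _ _ h₁ h₂ => rw [map_add]; exact h₁.add_left h₂
  | smul c a _ h => rw [map_smul]; exact h.smul_left c

end

theorem HasCompactCoeff.hasCompactSupport (hZ : π.HasCentralCharacter) {u v : H}
    (h : HasCompactCoeff π u v) (u' v' : H) : HasCompactSupport (π.coeffProduct u v u' v') := by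
  obtain ⟨C, hC, h⟩ := h
  refine HasCompactSupport.of_support_subset_isCompact hC fun q hq => ?_
  obtain ⟨g, rfl⟩ := QuotientGroup.mk_surjective q
  rw [Function.mem_support, coeffProduct_mk hZ] at hq
  exact h g (left_ne_zero_of_mul hq)

variable [MeasurableSpace (G ⧸ Subgroup.center G)] [BorelSpace (G ⧸ Subgroup.center G)]
  {μ : Measure (G ⧸ Subgroup.center G)} [μ.IsHaarMeasure]

theorem integrable_coeffProduct_of_hasCompactCoeff (hZ : π.HasCentralCharacter) {u v : H}
    (h : HasCompactCoeff π u v) (u' v' : H) : Integrable (π.coeffProduct u v u' v') μ :=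
  (continuous_coeffProduct hZ u v u' v').integrable_of_hasCompactSupport
    (h.hasCompactSupport hZ u' v')

/-- Right invariance of the integral on continuous functions with compact support. -/
def IsRightInvariantOnCompactSupport (μ : Measure (G ⧸ Subgroup.center G)) : Prop :=
  ∀ (x : G ⧸ Subgroup.center G) (f : G ⧸ Subgroup.center G → ℂ), Continuous f →
    HasCompactSupport f → ∫ q, f (q * x) ∂μ = ∫ q, f q ∂μ

variable (hΛ : IsIrreduciblyInducing Λ) (hι : Function.Injective ι)
  (hπ : ∀ g x, ι (compactInduction J Λ g x) = π.toHom g (ι x))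
  (hZ : π.HasCentralCharacter)
  (hJc : IsCompact ((QuotientGroup.mk : G → G ⧸ Subgroup.center G) '' J))
  (hR : IsRightInvariantOnCompactSupport μ)

include hΛ hι hπ hZ hJc hR

/-- Schur's relations on the compact induction, with an unspecified constant. -/
theorem exists_integral_coeffProduct_eq : ∃ c : ℂ, ∀ a b a' b' : compactInductionSpace J Λ,
    ∫ q, π.coeffProduct (ι a) (ι b) (ι a') (ι b') q ∂μ =
      c * (inner ℂ (ι a') (ι a) * inner ℂ (ι b) (ι b')) := by
  have hcc := hasCompactCoeff_compactInduction hΛ hπ hJc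
  have hint : ∀ a b u' v', Integrable (π.coeffProduct (ι a) (ι b) u' v') μ := fun a b u' v' =>
    integrable_coeffProduct_of_hasCompactCoeff hZ (hcc a b) u' v'
  -- For fixed b, b' the integral is an invariant form in (a', a), by right invariance of the
  -- measure.
  have h1 : ∀ b b', ∃ c : ℂ, ∀ a a', ∫ q, π.coeffProduct (ι a) (ι b) (ι a') (ι b') q ∂μ =
      c * inner ℂ (ι a') (ι a) := by
    intro b b'
    let B : compactInductionSpace J Λ →ₗ⋆[ℂ] compactInductionSpace J Λ →ₗ[ℂ] ℂ :=
      LinearMap.mk₂'ₛₗ (starRingEnd ℂ) (RingHom.id ℂ)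
        (fun a' a => ∫ q, π.coeffProduct (ι a) (ι b) (ι a') (ι b') q ∂μ)
        (fun _ _ _ => by
          rw [map_add, coeffProduct_add_third]
          exact integral_add (hint _ _ _ _) (hint _ _ _ _))
        (fun c _ _ => by
          rw [map_smul, coeffProduct_smul_third]
          exact integral_smul (starRingEnd ℂ c) (π.coeffProduct _ _ _ _))
        (fun _ _ _ => by
          rw [map_add, coeffProduct_add_first]
          exact integral_add (hint _ _ _ _) (hint _ _ _ _))
        (fun c _ _ => by
          rw [map_smul, coeffProduct_smul_first]
          exact integral_smul (c) (π.coeffProduct _ _ _ _))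
    obtain ⟨c, hc⟩ := exists_invariantForm_eq_inner hΛ π ι hι hπ B (fun g a' a => by
      change ∫ q, π.coeffProduct (ι (compactInduction J Λ g a)) (ι b)
        (ι (compactInduction J Λ g a')) (ι b') q ∂μ =
        ∫ q, π.coeffProduct (ι a) (ι b) (ι a') (ι b') q ∂μ
      rw [hπ, hπ]
      simp_rw [coeffProduct_mul_right hZ]
      exact hR _ _ (continuous_coeffProduct hZ _ _ _ _) ((hcc a b).hasCompactSupport hZ _ _))
    exact ⟨c, fun a a' => hc a' a⟩
  -- For fixed a, a' it is an invariant form in (b, b'), by left invariance.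
  have h2 : ∀ a a', ∃ c : ℂ, ∀ b b', ∫ q, π.coeffProduct (ι a) (ι b) (ι a') (ι b') q ∂μ =
      c * inner ℂ (ι b) (ι b') := by
    intro a a'
    let B : compactInductionSpace J Λ →ₗ⋆[ℂ] compactInductionSpace J Λ →ₗ[ℂ] ℂ :=
      LinearMap.mk₂'ₛₗ (starRingEnd ℂ) (RingHom.id ℂ)
        (fun b b' => ∫ q, π.coeffProduct (ι a) (ι b) (ι a') (ι b') q ∂μ)
        (fun _ _ _ => by
          rw [map_add, coeffProduct_add_second]
          exact integral_add (hint _ _ _ _) (hint _ _ _ _))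
        (fun c _ _ => by
          rw [map_smul, coeffProduct_smul_second]
          exact integral_smul (starRingEnd ℂ c) (π.coeffProduct _ _ _ _))
        (fun _ _ _ => by
          rw [map_add, coeffProduct_add_fourth]
          exact integral_add (hint _ _ _ _) (hint _ _ _ _))
        (fun c _ _ => by
          rw [map_smul, coeffProduct_smul_fourth]
          exact integral_smul (c) (π.coeffProduct _ _ _ _))
    exact exists_invariantForm_eq_inner hΛ π ι hι hπ B (fun g b b' => by
      change ∫ q, π.coeffProduct (ι a) (ι (compactInduction J Λ g b))
        (ι a') (ι (compactInduction J Λ g b')) q ∂μ =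
        ∫ q, π.coeffProduct (ι a) (ι b) (ι a') (ι b') q ∂μ
      rw [hπ, hπ]
      simp_rw [coeffProduct_mul_left hZ]
      exact integral_mul_left_eq_self _ _)
  by_cases hE : ∃ a₀, ι a₀ ≠ 0
  · obtain ⟨a₀, ha₀⟩ := hE
    have ha₀' : inner ℂ (ι a₀) (ι a₀) ≠ 0 := fun h => ha₀ (inner_self_eq_zero.1 h)
    obtain ⟨c, hc⟩ := h2 a₀ a₀
    -- Evaluating both relations at a = a' = a₀ separates the variables.
    refine ⟨c / inner ℂ (ι a₀) (ι a₀), fun a b a' b' => ?_⟩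
    obtain ⟨d, hd⟩ := h1 b b'
    have h3 := hd a₀ a₀
    rw [hc] at h3
    rw [hd, eq_div_of_mul_eq ha₀' h3.symm]
    ring
  · push Not at hE
    refine ⟨0, fun a b a' b' => ?_⟩
    obtain ⟨d, hd⟩ := h1 b b'
    rw [hd, hE a, inner_zero_right, zero_mul, mul_zero]

/-- Schur's relations on the compact induction. -/
theorem integral_coeffProduct_compactInduction [Nontrivial V]
    (hcenter : Subgroup.center G ≤ J) (a b a' b' : compactInductionSpace J Λ) :
    ∫ q, π.coeffProduct (ι a) (ι b) (ι a') (ι b') q ∂μ =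
      ((μ.real ((QuotientGroup.mk : G → G ⧸ Subgroup.center G) '' J) / Module.finrank ℂ V : ℝ) : ℂ) *
        (inner ℂ (ι a') (ι a) * inner ℂ (ι b) (ι b')) := by
  obtain ⟨c, hc⟩ := exists_integral_coeffProduct_eq hΛ hι hπ hZ hJc hR
  suffices hcv : c = ((μ.real ((QuotientGroup.mk : G → G ⧸ Subgroup.center G) '' J) /
      Module.finrank ℂ V : ℝ) : ℂ) by
    rw [← hcv]
    exact hc a b a' b'
  let e : V →ₗ[ℂ] H := ι ∘ₗ extendByZero hΛ.isTrivialOnOpen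
  have he : Function.Injective e := hι.comp (extendByZero_injective hΛ.isTrivialOnOpen)
  let W := LinearMap.range e
  let β := stdOrthonormalBasis ℂ W
  have hfr : Module.finrank ℂ W = Module.finrank ℂ V := LinearMap.finrank_range_of_inj he
  choose w hw using fun i => (β i).2
  obtain ⟨v₀, hv₀⟩ := exists_ne (0 : V)
  have hv₀' : ‖e v₀‖ ^ 2 ≠ 0 := by
    rw [ne_eq, sq_eq_zero_iff, norm_eq_zero]
    exact fun h => hv₀ (he (h.trans (map_zero e).symm))
  -- On J the vector π(g)(e v₀) stays in the copy `W` of V and Parseval gives its squared norm; off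
  -- J every coefficient vanishes. Integrating yields dim V · c = vol(J/Z).
  have hsum : ∀ q, ∑ i, π.coeffProduct (e v₀) (e (w i)) (e v₀) (e (w i)) q =
      (QuotientGroup.mk '' (J : Set G)).indicator (fun _ => ((‖e v₀‖ ^ 2 : ℝ) : ℂ)) q := by
    intro q
    obtain ⟨g, rfl⟩ := QuotientGroup.mk_surjective q
    by_cases hg : g ∈ J
    · rw [Set.indicator_of_mem (Set.mem_image_of_mem _ hg)]
      have hgW : π.toHom g (e v₀) ∈ W := by
        refine ⟨Λ ⟨g, hg⟩ v₀, ?_⟩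
        have := compactInduction_extendByZero hΛ.isTrivialOnOpen (⟨g, hg⟩ : J) v₀
        change ι _ = π.toHom g (ι _)
        rw [← hπ, ← this]
      let y : W := ⟨π.toHom g (e v₀), hgW⟩
      have h1 := β.sum_sq_norm_inner_right y
      have h2 : ‖y‖ = ‖e v₀‖ := (π.toHom g).norm_map _
      rw [h2] at h1
      rw [← h1, Complex.ofReal_sum]
      refine Finset.sum_congr rfl fun i _ => ?_
      rw [coeffProduct_mk hZ, Complex.mul_conj, Complex.normSq_eq_norm_sq, hw i]
      rfl
    · rw [Set.indicator_of_notMem]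
      · refine Finset.sum_eq_zero fun i _ => ?_
        rw [coeffProduct_mk hZ]
        have := inner_eq_zero_of_notMem hΛ hπ hg (w i) v₀
        change inner ℂ (e (w i)) (π.toHom g (e v₀)) = 0 at this
        rw [this, zero_mul]
      · rintro ⟨j, hj, h⟩
        rw [QuotientGroup.eq] at h
        exact hg ((Subgroup.mul_mem_cancel_left J (inv_mem hj)).1 (hcenter h))
  have hopen : IsOpen ((QuotientGroup.mk : G → G ⧸ Subgroup.center G) '' J) :=
    QuotientGroup.isOpenMap_coe _ hΛ.isTrivialOnOpen.isOpen
  have hie : ∀ i, Integrable (π.coeffProduct (e v₀) (e (w i)) (e v₀) (e (w i))) μ := fun i =>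
    integrable_coeffProduct_of_hasCompactCoeff hZ
      (hasCompactCoeff_compactInduction hΛ hπ hJc _ _) _ _
  have hI := integral_congr_ae (μ := μ) (Filter.Eventually.of_forall hsum)
  rw [integral_indicator_const _ hopen.measurableSet, integral_finsetSum _ (fun i _ => hie i)] at hI
  have hterm : ∀ i, ∫ q, π.coeffProduct (e v₀) (e (w i)) (e v₀) (e (w i)) q ∂μ =
      c * ((‖e v₀‖ ^ 2 : ℝ) : ℂ) := by
    intro i
    have h1 : inner ℂ (e (w i)) (e (w i)) = (1 : ℂ) := by
      rw [hw i]
      exact inner_self_eq_one_of_norm_eq_one (β.norm_eq_one i)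
    have h2 : inner ℂ (e v₀) (e v₀) = ((‖e v₀‖ ^ 2 : ℝ) : ℂ) := by
      rw [inner_self_eq_norm_sq_to_K]
      push_cast
      rfl
    rw [← h2]
    refine (hc _ _ _ _).trans ?_
    change c * (inner ℂ (e v₀) (e v₀) * inner ℂ (e (w i)) (e (w i))) = _
    rw [h1, mul_one]
  rw [Finset.sum_congr rfl (fun i _ => hterm i), Finset.sum_const, Finset.card_univ,
    Fintype.card_fin, hfr, nsmul_eq_mul, ← mul_assoc, Complex.real_smul] at hI
  have hI' := mul_right_cancel₀ (Complex.ofReal_ne_zero.2 hv₀') hI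
  have hd : (Module.finrank ℂ V : ℂ) ≠ 0 := Nat.cast_ne_zero.2 Module.finrank_pos.ne'
  rw [Complex.ofReal_div, Complex.ofReal_natCast, ← hI', mul_div_cancel_left₀ _ hd]

end Schur

/-! ### Unimodularity of `GL(2, F)/Z` -/

section Unimodular

open Measure

section

variable {Q : Type*} [Group Q] [TopologicalSpace Q] [IsTopologicalGroup Q] [LocallyCompactSpace Q]

/-- Right translation by x preserves S, whose Haar measure is positive and finite. -/
theorem modularCharacterFun_eq_one_of_isOpen_of_isCompact {S : Subgroup Q}
    (hS : IsOpen (S : Set Q)) (hS' : IsCompact (S : Set Q)) {x : Q} (hx : x ∈ S) :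
    modularCharacterFun x = 1 := by
  borelize Q
  have h := measure_isMulInvariant_eq_smul_of_isCompact_closure (map (· * x) (haar : Measure Q))
    haar hS'.closure
  rw [← modularCharacterFun_eq_haarScalarFactor, map_apply (measurable_mul_const x)
    hS.measurableSet] at h
  have hpre : (· * x) ⁻¹' (S : Set Q) = S :=
    Set.ext fun y => Subgroup.mul_mem_cancel_right S hx
  rw [hpre, ENNReal.smul_def, smul_eq_mul] at h
  have h0 : (haar : Measure Q) (S : Set Q) ≠ 0 := (hS.measure_pos _ ⟨1, one_mem S⟩).ne'
  have h1 : (haar : Measure Q) (S : Set Q) ≠ ⊤ := hS'.measure_lt_top.ne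
  have h2 := (ENNReal.mul_eq_right h0 h1).1 h.symm
  exact_mod_cast h2

/-- The right translate of μ is again left invariant. Since μ is not assumed regular, it is compared
with μ only on compactly supported continuous functions, through real and imaginary parts. -/
theorem integral_mul_right_eq_self_of_modularCharacterFun_eq_one [MeasurableSpace Q] [BorelSpace Q]
    (μ : Measure Q) [μ.IsHaarMeasure] {x : Q} (hx : modularCharacterFun x = 1) {f : Q → ℂ}
    (hf : Continuous f) (hf' : HasCompactSupport f) : ∫ q, f (q * x) ∂μ = ∫ q, f q ∂μ := by
  have hreal : ∀ f : Q → ℝ, Continuous f → HasCompactSupport f →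
      ∫ q, f (q * x) ∂μ = ∫ q, f q ∂μ := by
    intro f hf hf'
    have h := integral_isMulLeftInvariant_eq_smul_of_hasCompactSupport (map (· * x) μ) μ hf hf'
    rwa [← modularCharacterFun_eq_haarScalarFactor, hx, one_smul,
      integral_map (measurable_mul_const x).aemeasurable hf.aestronglyMeasurable] at h
  have hint : Integrable f μ := hf.integrable_of_hasCompactSupport hf'
  have hint' : Integrable (fun q => f (q * x)) μ :=
    (hf.comp (continuous_mul_const x)).integrable_of_hasCompactSupport
      (hf'.comp_homeomorph (Homeomorph.mulRight x))
  refine Complex.ext ?_ ?_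
  · rw [← RCLike.re_eq_complex_re, ← integral_re hint, ← integral_re hint']
    exact hreal (fun q => (f q).re) (Complex.continuous_re.comp hf) (hf'.comp_left rfl)
  · rw [← RCLike.im_eq_complex_im, ← integral_im hint, ← integral_im hint']
    exact hreal (fun q => (f q).im) (Complex.continuous_im.comp hf) (hf'.comp_left rfl)

end

variable (F : Type*) [Field F] [ValuativeRel F] [TopologicalSpace F] [IsNonarchimedeanLocalField F]

/-- Modulo Z the group ZK has the same image as the compact group K; it is closed because it is an
open subgroup. -/
theorem isCompact_image_centerMaximalCompactGL2 :
    IsCompact ((QuotientGroup.mk : GL (Fin 2) F → GL (Fin 2) F ⧸ Subgroup.center (GL (Fin 2) F)) ''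
      centerMaximalCompactGL2 F) := by
  refine ((maximalCompactGL2_isCompact F).image QuotientGroup.continuous_mk).of_isClosed_subset
    ?_ ?_
  · have h : IsOpen (((centerMaximalCompactGL2 F).map
        (QuotientGroup.mk' (Subgroup.center (GL (Fin 2) F))) : Subgroup _) :
        Set (GL (Fin 2) F ⧸ Subgroup.center (GL (Fin 2) F))) :=
      QuotientGroup.isOpenMap_coe _ (centerMaximalCompactGL2_isOpen F)
    exact Subgroup.isClosed_of_isOpen _ h
  · rintro _ ⟨j, hj, rfl⟩
    obtain ⟨z, hz, k, hk, rfl⟩ := Subgroup.mem_sup_of_normal_left.1 hj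
    exact ⟨k, hk, by rw [QuotientGroup.mk_mul, (QuotientGroup.eq_one_iff z).2 hz, one_mul]⟩

/-- By the Cartan decomposition only diagonal matrices matter. The permutation matrix lies in K, so
diag(a, b) and diag(b, a) have equal modulus, while their product is central. The modulus is thus a
nonnegative number with square 1. -/
theorem modularCharacterFun_GL2_eq_one (x : GL (Fin 2) F ⧸ Subgroup.center (GL (Fin 2) F)) :
    modularCharacterFun x = 1 := by
  let Δ : GL (Fin 2) F →* NNReal :=
    modularCharacter.comp (QuotientGroup.mk' (Subgroup.center (GL (Fin 2) F)))
  have hZ : ∀ z ∈ Subgroup.center (GL (Fin 2) F), Δ z = 1 := fun z hz => by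
    rw [MonoidHom.comp_apply, QuotientGroup.mk'_apply, (QuotientGroup.eq_one_iff z).2 hz, map_one]
  have hK : ∀ k ∈ maximalCompactGL2 F, Δ k = 1 := fun k hk =>
    modularCharacterFun_eq_one_of_isOpen_of_isCompact
      (S := (centerMaximalCompactGL2 F).map (QuotientGroup.mk' _))
      (QuotientGroup.isOpenMap_coe _ (centerMaximalCompactGL2_isOpen F))
      (isCompact_image_centerMaximalCompactGL2 F) ⟨k, maximalCompactGL2_le hk, rfl⟩
  obtain ⟨g, rfl⟩ := QuotientGroup.mk_surjective x
  obtain ⟨k, hk, k', hk', a, b, rfl⟩ := exists_cartan g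
  change Δ (k * diagGL2 a b * k') = 1
  rw [map_mul, map_mul, hK k hk, hK k' hk', one_mul, mul_one]
  have h1 : Δ (diagGL2 b a) = Δ (diagGL2 a b) := by
    rw [← swapGL2_mul_diagGL2_mul_swapGL2, map_mul, map_mul,
      hK _ swapGL2_mem_maximalCompactGL2, one_mul, mul_one]
  have h2 : Δ (diagGL2 a b) * Δ (diagGL2 b a) = 1 := by
    rw [← map_mul, ← diagGL2_mul, mul_comm b a]
    exact hZ _ (diagGL2_self_mem_center _)
  rw [h1, ← pow_two] at h2
  exact (pow_eq_one_iff_of_nonneg zero_le two_ne_zero).1 h2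

theorem isRightInvariantOnCompactSupport_GL2
    [MeasurableSpace (GL (Fin 2) F ⧸ Subgroup.center (GL (Fin 2) F))]
    [BorelSpace (GL (Fin 2) F ⧸ Subgroup.center (GL (Fin 2) F))]
    (μ : Measure (GL (Fin 2) F ⧸ Subgroup.center (GL (Fin 2) F))) [μ.IsHaarMeasure] :
    IsRightInvariantOnCompactSupport μ := fun x _ hf hf' =>
  integral_mul_right_eq_self_of_modularCharacterFun_eq_one μ
    (modularCharacterFun_GL2_eq_one F x) hf hf'

end Unimodular

/-! ### The main theorem -/

section DepthZero

variable {F : Type*} [Field F] [ValuativeRel F] [TopologicalSpace F] [IsNonarchimedeanLocalField F]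

theorem IsCuspidal.nontrivial {k : Type*} [Field k] [Finite k] {V : Type*} [AddCommGroup V]
    [Module ℂ V] [FiniteDimensional ℂ V] {ρ : Representation ℂ (GL (Fin 2) k) V}
    (hρ : IsCuspidal ρ) : Nontrivial V := by
  have := Fintype.ofFinite k
  refine Module.nontrivial_of_finrank_pos (R := ℂ) (Nat.pos_of_ne_zero fun h => ?_)
  have h1 := hρ.finrank_eq
  rw [h, Nat.cast_zero, eq_comm, sub_eq_zero] at h1
  exact Fintype.one_lt_card.ne' (Nat.cast_eq_one.1 h1)

section

variable {V : Type*} [NormedAddCommGroup V] [InnerProductSpace ℂ V] [FiniteDimensional ℂ V]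
  {Λ₀ : Representation ℂ (GL (Fin 2) 𝓀[F]) V} {Λ : Representation ℂ (centerMaximalCompactGL2 F) V}

theorem RestrictsToInflation.isIrreduciblyInducing (hΛ₀ : IsCuspidal Λ₀)
    (hΛ : RestrictsToInflation Λ Λ₀) (hinner : ∀ j v w, inner ℂ (Λ j v) (Λ j w) = inner ℂ v w) :
    IsIrreduciblyInducing Λ where
  isTrivialOnOpen := ⟨⟨congruenceGL2 F, congruenceGL2_isOpen F⟩,
    fun _ hg => maximalCompactGL2_le (congruenceGL2_le hg), hΛ.apply_congruence⟩
  inner_map := hinner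
  schur := hΛ.exists_eq_smul_id hΛ₀
  intertwiner := hΛ.intertwiner_eq_zero hΛ₀

end

/-- For central z, right translation by z is left translation, hence the scalar ω(z) on the compact
induction; density extends this to H. -/
theorem hasCentralCharacter_of_isCompletionOf {V : Type*} [AddCommGroup V] [Module ℂ V]
    {Λ : Representation ℂ (centerMaximalCompactGL2 F) V}
    {ω : Subgroup.center (GL (Fin 2) F) →* Circle} (hω : HasUnitaryCentralCharacter Λ ω)
    {H : Type*} [NormedAddCommGroup H] [InnerProductSpace ℂ H] {π : UnitaryRep (GL (Fin 2) F) H}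
    (hπ : π.IsCompletionOf (compactInduction (centerMaximalCompactGL2 F) Λ)) :
    π.HasCentralCharacter := by
  obtain ⟨ι, -, hd, hπ⟩ := hπ
  intro z hz
  refine ⟨ω ⟨z, hz⟩, fun u => ?_⟩
  refine hd.induction_on (p := fun u => π.toHom z u = (ω ⟨z, hz⟩ : ℂ) • u) u
    (isClosed_eq (π.toHom z).continuous (continuous_const_smul _)) fun f => ?_
  rw [← hπ, ← map_smul]
  congr 1
  ext g
  rw [compactInduction_apply, (Subgroup.mem_center_iff.1 hz g)]
  have h1 := f.2.1 ⟨z, Subgroup.mem_sup_left hz⟩ g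
  rw [hω ⟨z, hz⟩] at h1
  exact h1

variable [MeasurableSpace (GL (Fin 2) F ⧸ Subgroup.center (GL (Fin 2) F))]
  [BorelSpace (GL (Fin 2) F ⧸ Subgroup.center (GL (Fin 2) F))]
  {μ : Measure (GL (Fin 2) F ⧸ Subgroup.center (GL (Fin 2) F))} [μ.IsHaarMeasure]
  {V : Type*} [NormedAddCommGroup V] [InnerProductSpace ℂ V] [FiniteDimensional ℂ V]
  {Λ₀ : Representation ℂ (GL (Fin 2) 𝓀[F]) V} {Λ : Representation ℂ (centerMaximalCompactGL2 F) V}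

theorem isDiscreteSeries_and_hasFormalDimension
    (hμ : μ (QuotientGroup.mk '' (centerMaximalCompactGL2 F : Set (GL (Fin 2) F))) =
      ENNReal.ofReal (((Nat.card 𝓀[F] : ℝ) - 1) / 2))
    (hΛ₀ : IsCuspidal Λ₀) (hΛ : RestrictsToInflation Λ Λ₀)
    (hinner : ∀ j v w, inner ℂ (Λ j v) (Λ j w) = inner ℂ v w)
    {ω : Subgroup.center (GL (Fin 2) F) →* Circle} (hω : HasUnitaryCentralCharacter Λ ω)
    {H : Type*} [NormedAddCommGroup H] [InnerProductSpace ℂ H] [CompleteSpace H]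
    {π : UnitaryRep (GL (Fin 2) F) H}
    (hπ : π.IsCompletionOf (compactInduction (centerMaximalCompactGL2 F) Λ)) :
    π.IsDiscreteSeries μ ∧ π.HasFormalDimension μ 2 := by
  have := hΛ₀.nontrivial
  have hInd := hΛ.isIrreduciblyInducing hΛ₀ hinner
  have hZ := hasCentralCharacter_of_isCompletionOf hω hπ
  have hirr := isIrreducible_of_isCompletionOf hInd π hπ
  obtain ⟨ι, hι, hd, hπ⟩ := hπ
  have hJc := isCompact_image_centerMaximalCompactGL2 F
  -- The factor q - 1 in the normalization of the volume cancels dim V = q - 1.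
  have hc : μ.real ((QuotientGroup.mk : GL (Fin 2) F → GL (Fin 2) F ⧸ Subgroup.center _) ''
      centerMaximalCompactGL2 F) / Module.finrank ℂ V = 1 / 2 := by
    have := Fintype.ofFinite 𝓀[F]
    have hcard : (1 : ℝ) < Nat.card 𝓀[F] := by exact_mod_cast Finite.one_lt_card
    have hfin : (Module.finrank ℂ V : ℝ) = Nat.card 𝓀[F] - 1 := by
      have := hΛ₀.finrank_eq
      rw [← Nat.card_eq_fintype_card] at this
      exact_mod_cast this
    have h0 : (Nat.card 𝓀[F] : ℝ) - 1 ≠ 0 := by linarith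
    rw [measureReal_def, hμ, ENNReal.toReal_ofReal (by linarith), hfin]
    field_simp
  have hS : ∀ a b a' b', ∫ q, π.coeffProduct (ι a) (ι b) (ι a') (ι b') q ∂μ =
      ((1 / 2 : ℝ) : ℂ) * (inner ℂ (ι a') (ι a) * inner ℂ (ι b) (ι b')) := by
    intro a b a' b'
    rw [← hc]
    exact integral_coeffProduct_compactInduction hInd hι hπ hZ hJc
      (isRightInvariantOnCompactSupport_GL2 F μ) center_le_centerMaximalCompactGL2 a b a' b'
  have hle := UnitaryRep.lintegral_coeffProduct_self_le hZ hd
    (fun a b => integrable_coeffProduct_of_hasCompactCoeff hZ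
      (hasCompactCoeff_compactInduction hInd hπ hJc a b) _ _) (fun a b => hS a b a b)
  have hint := UnitaryRep.integrable_coeffProduct hZ hle
  refine ⟨⟨hirr, fun u v => ⟨fun q => ‖π.coeffProduct u v u v q‖, fun g => ?_,
    (hint u v u v).norm⟩⟩, two_pos, fun u v u' v' => ⟨π.coeffProduct u v u' v',
      UnitaryRep.coeffProduct_mk hZ u v u' v', hint u v u' v', ?_⟩⟩
  · beta_reduce
    rw [UnitaryRep.coeffProduct_mk hZ, norm_mul, RCLike.norm_conj, pow_two]
  · rw [UnitaryRep.integral_coeffProduct_of_dense hZ hle (by norm_num) hd hS, inner_conj_symm]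
    push_cast
    rfl

end DepthZero

theorem mainTheorem6
    (F : Type u) [Field F] [ValuativeRel F] [TopologicalSpace F] [IsNonarchimedeanLocalField F]
    [MeasurableSpace (GL (Fin 2) F ⧸ Subgroup.center (GL (Fin 2) F))]
    [BorelSpace (GL (Fin 2) F ⧸ Subgroup.center (GL (Fin 2) F))]
    (μ : Measure (GL (Fin 2) F ⧸ Subgroup.center (GL (Fin 2) F))) [μ.IsHaarMeasure]
    (hμ : μ (QuotientGroup.mk '' (centerMaximalCompactGL2 F : Set (GL (Fin 2) F))) =
      ENNReal.ofReal (((Nat.card 𝓀[F] : ℝ) - 1) / 2))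
    (V : Type v) [AddCommGroup V] [Module ℂ V] [FiniteDimensional ℂ V]
    (Λ₀ : Representation ℂ (GL (Fin 2) 𝓀[F]) V) (hΛ₀ : IsCuspidal Λ₀)
    (Λ : Representation ℂ (centerMaximalCompactGL2 F) V) (hΛ : RestrictsToInflation Λ Λ₀)
    (ω : Subgroup.center (GL (Fin 2) F) →* Circle) (hω : HasUnitaryCentralCharacter Λ ω) :
    (∃ (H : Type (max u v)) (_ : NormedAddCommGroup H) (_ : InnerProductSpace ℂ H)
        (_ : CompleteSpace H) (π : UnitaryRep (GL (Fin 2) F) H),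
        π.IsCompletionOf (compactInduction (centerMaximalCompactGL2 F) Λ)) ∧
      ∀ (H : Type w) [NormedAddCommGroup H] [InnerProductSpace ℂ H] [CompleteSpace H]
        (π : UnitaryRep (GL (Fin 2) F) H),
        π.IsCompletionOf (compactInduction (centerMaximalCompactGL2 F) Λ) →
          π.IsDiscreteSeries μ ∧ π.HasFormalDimension μ 2 := by
  -- V carries no norm a priori; it is given the norm of a Λ-invariant inner product.
  obtain ⟨c, hc⟩ := hΛ.exists_invariant_core hω
  let : NormedAddCommGroup V := c.toNormedAddCommGroup
  let : InnerProductSpace ℂ V := InnerProductSpace.ofCore c.toCore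
  have hinner : ∀ j v w, inner ℂ (Λ j v) (Λ j w) = inner ℂ v w := hc
  have : CompleteSpace V := FiniteDimensional.complete ℂ V
  refine ⟨exists_isCompletionOf_compactInduction (centerMaximalCompactGL2_isOpen F)
    fun j v => ?_, fun H _ _ _ π hπ => isDiscreteSeries_and_hasFormalDimension hμ hΛ₀ hΛ hinner hω hπ⟩
  rw [norm_eq_sqrt_re_inner (𝕜 := ℂ), norm_eq_sqrt_re_inner (𝕜 := ℂ), hinner]
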